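/- Let $\mathcal X$ be a measurable space. A symmetric regression algorithm $\mathcal A$ maps each data set $D\in(\mathcal X\times\mathbb R)^n$, of any size $n\ge 0$, to a function $\mathcal A(D):\mathcal X\to\mathbb R$, such that $(D,x)\mapsto\mathcal A(D)(x)$ is measurable for each $n$ and $\mathcal A(D)$ does not depend on the order of the points of $D$. Let $P$ be a probability distribution on $\mathcal X\times\mathbb R$ and $\alpha\in[0,1]$. For $\mathcal D_n=((X_1,Y_1),\dots,(X_n,Y_n))$, $n\ge1$, $x\in\mathcal X$ and $y\in\mathbb R$ let $\widehat\mu^{x,y}=\mathcal A((X_1,Y_1),\dots,(X_n,Y_n),(x,y))$, and for $\gamma>0$ define the $\gamma$-inflated full conformal prediction set $$\widehat C_n^{\gamma\text{-CP}}(x)=\Big\{y\in\mathbb R:\ |y-\widehat\mu^{x,y}(x)|\le \mathrm{Quantile}\big(\{|Y_i-\widehat\mu^{x,y}(X_i)|\}_{i\in[n]};(1-\alpha)(1+1/n)\big)+\gamma\Big\},$$ where $\mathrm{Quantile}(\{v_i\}_{i\in[n]};\tau)=\inf\{t\in\mathbb R:\ \tfrac1n\#\{i:v_i\le t\}\ge\tau\}\in[-\infty,\infty]$,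 with $\inf\emptyset=+\infty$. Its training-conditional miscoverage rate is $$\alpha_P^{\gamma\text{-CP}}(\mathcal D_n)=\mathbb P\{Y\notin\widehat C_n^{\gamma\text{-CP}}(X)\mid\mathcal D_n\},\qquad (X,Y)\sim P \text{ independent of }\mathcal D_n .$$ For $0\le m<n$ the in-sample $m$-swap-stability is $$\bar\beta^{\mathrm{in}}_{m,n}(\mathcal A,P)=\mathbb E\big[|\widehat\mu_n(X_1)-\widehat\mu_n'(X_1)|\big]\in[0,\infty],$$ where $\widehat\mu_n=\mathcal A((X_1,Y_1),\dots,(X_n,Y_n))$, $\widehat\mu_n'=\mathcal A((X_1,Y_1),\dots,(X_{n-m},Y_{n-m}),(X'_{n-m+1},Y'_{n-m+1}),\dots,(X'_n,Y'_n))$ and all $(X_i,Y_i),(X_i',Y_i')$ are i.i.d. from $P$. Let $\bar\beta^{*,\mathrm{in}}_{1,n}(\mathcal A,P)=\sup_{n'\ge n}\bar\beta^{\mathrm{in}}_{1,n'}(\mathcal A,P)$. (a) (Finite sample.) For every $\mathcal X$, $P$, symmetric $\mathcal A$, $\alpha\in[0,1]$, $n\ge1$, $\gamma>0$, every $m$ with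 $1\le m\le n+1$ and every $\delta\in(0,1)$, $$\mathbb P\left\{\alpha_P^{\gamma\text{-CP}}(\mathcal D_n)<\alpha+3\sqrt{\frac{\log(1/\delta)}{2\min\{n,m\}}}+2\sqrt[3]{\frac{2\bar\beta^{\mathrm{in}}_{m-1,n+1}(\mathcal A,P)}{\gamma}}\right\}\ \ge\ 1-3\delta-\sqrt[3]{\frac{2\bar\beta^{\mathrm{in}}_{m-1,n+1}(\mathcal A,P)}{\gamma}},$$ where $\mathcal D_n$ consists of $n$ i.i.d. draws from $P$. (b) (Asymptotic.) For all sequences $b_n,\gamma_n>0$ with $b_n/\gamma_n\to0$ there is a sequence $\epsilon_n\to0$ such that, for every $\mathcal X$ and every $\alpha\in[0,1]$, $$\lim_{n\to\infty}\ \sup_{\substack{\mathcal A,P\ \text{s.t.}\\ \bar\beta^{*,\mathrm{in}}_{1,n+1}(\mathcal A,P)\le b_n}}\ \mathbb P\left\{\alpha_P^{\gamma_n\text{-CP}}(\mathcal D_n)\ge\alpha+\epsilon_n\right\}=0,$$ where the supremum is over symmetric algorithms $\mathcal A$ and distributions $P$ on $\mathcal X\times\mathbb R$. -/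

import Mathlib

open MeasureTheory Filter Topology
open scoped ENNReal

universe u

noncomputable section

/-- A symmetric regression algorithm on the feature space `𝒳`: it maps a data set of any size `n`
to a fitted regression function `𝒳 → ℝ`, does not depend on the order of the data points, and is
measurable (jointly in the data set and the test feature, so that each fitted function is
measurable and all expected values and probabilities below are meaningful). -/
structure RegressionAlgorithm (𝒳 : Type u) [MeasurableSpace 𝒳] where
  /-- The fitted regression function `fit n D : 𝒳 → ℝ` on the data set `D` of size `n`. -/
  fit : (n : ℕ) → (Fin n → 𝒳 × ℝ) → 𝒳 → ℝ
  measurable_fit : ∀ n : ℕ,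
    Measurable (fun p : (Fin n → 𝒳 × ℝ) × 𝒳 => fit n p.1 p.2)
  fit_perm : ∀ (n : ℕ) (π : Equiv.Perm (Fin n)) (D : Fin n → 𝒳 × ℝ),
    fit n (fun i => D (π i)) = fit n D

/-- The empirical quantile `inf {t ∈ ℝ : #{i : v i ≤ t} / n ≥ τ}` at level `τ` of the values
`v 0, …, v (n - 1)`, as an extended real number: it is `+∞` if `τ > 1`. -/
def empQuantile {n : ℕ} (v : Fin n → ℝ) (τ : ℝ) : EReal :=
  ⨅ (t : ℝ) (_ : τ ≤ (Nat.card {i : Fin n // v i ≤ t} : ℝ) / (n : ℝ)), (t : EReal)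

variable {𝒳 : Type u} [MeasurableSpace 𝒳]

/-- The model fitted on the training data `D` together with the hypothesized test point
`(x, y)`. -/
def augmentedFit (A : RegressionAlgorithm 𝒳) {n : ℕ} (D : Fin n → 𝒳 × ℝ) (x : 𝒳) (y : ℝ) :
    𝒳 → ℝ :=
  A.fit (n + 1) (Fin.snoc (α := fun _ => 𝒳 × ℝ) D (x, y))

/-- The `γ`-inflated full conformal prediction set at the test feature `x`. -/
def conformalSet (A : RegressionAlgorithm 𝒳) (α γ : ℝ) {n : ℕ} (D : Fin n → 𝒳 × ℝ) (x : 𝒳) :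
    Set ℝ :=
  {y : ℝ | ((|y - augmentedFit A D x y x| : ℝ) : EReal) ≤
    empQuantile (fun i : Fin n => |(D i).2 - augmentedFit A D x y (D i).1|)
      ((1 - α) * (1 + 1 / (n : ℝ))) + (γ : EReal)}

/-- The training-conditional miscoverage rate of the `γ`-inflated full conformal prediction set
built on the training data `D`: the probability, for a new point `(X, Y) ∼ P` independent of the
training data, that `Y` is not in the prediction set at `X`. -/
def miscoverage (A : RegressionAlgorithm 𝒳) (P : Measure (𝒳 × ℝ)) (α γ : ℝ) {n : ℕ}
    (D : Fin n → 𝒳 × ℝ) : ℝ :=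
  P.real {z : 𝒳 × ℝ | z.2 ∉ conformalSet A α γ D z.1}

/-- The law of `n` i.i.d. data points with distribution `P`. -/
def iidLaw (P : Measure (𝒳 × ℝ)) (n : ℕ) : Measure (Fin n → 𝒳 × ℝ) :=
  Measure.pi (fun _ => P)

/-- The data set `D` with its last `m` points replaced by those of `D'`. -/
def swapLast (m : ℕ) {n : ℕ} (D D' : Fin n → 𝒳 × ℝ) : Fin n → 𝒳 × ℝ :=
  fun i => if (i : ℕ) < n - m then D i else D' i

/-- In-sample `m`-swap-stability at sample size `n`, for `m < n`: the expected value of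
`|μ(X₁) - μ'(X₁)|` in `[0, ∞]`, where `μ` is fitted on `n` i.i.d. points and `μ'` on the same
points with the last `m` replaced by independent copies. -/
def inSwapStability (A : RegressionAlgorithm 𝒳) (P : Measure (𝒳 × ℝ)) (m n : ℕ) (h : m < n) :
    ℝ≥0∞ :=
  ∫⁻ p : (Fin n → 𝒳 × ℝ) × (Fin n → 𝒳 × ℝ),
    ENNReal.ofReal
      |A.fit n p.1 (p.1 ⟨0, Nat.zero_lt_of_lt h⟩).1
        - A.fit n (swapLast m p.1 p.2) (p.1 ⟨0, Nat.zero_lt_of_lt h⟩).1|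
    ∂((iidLaw P n).prod (iidLaw P n))

/-- The supremum of the in-sample `1`-swap-stability over all sample sizes `k ≥ n` (at which it
is defined, that is, `k > 1`). -/
def inSwapStabilitySup (A : RegressionAlgorithm 𝒳) (P : Measure (𝒳 × ℝ)) (n : ℕ) : ℝ≥0∞ :=
  ⨆ (k : ℕ) (h : 1 < k) (_ : n ≤ k), inSwapStability A P 1 k h

end

/-! If the prediction set misses `z`, then the test residual at `z` exceeds by more than `γ` a
fraction at least `1 - α` of the training residuals, i.e. `z` lies in `exceedSet`. Were all
residuals those of one function independent of the sample, uniform concentration of empirical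
frequencies would bound the mass of such points by `α` plus an error. Here the fit depends on `z`
and on the sample, and stability has to remove both dependences.

By symmetry of the algorithm, the training residual at `D i` is the test residual at `D i` after `D
i` has been replaced by `z` (`testResidual_update`). Let `r` be the test residual function after the
last `m` points of `D` are replaced by independent copies. Given `r`, those `m` points are still
i.i.d. from `P`, so the DKW-type bound `lintegral_exp_upperDev_le` applies to them. Passing to `r`
from a training residual or from a test residual costs at most the swap-stability on average, and
the slack `γ` absorbs it: a ramp of width `γ` replaces the indicator of a half-line. Cyclic shifts
of `D` average the blocks of `m` points into the whole sample.

The deterministic core is `measure_exceedSet_add_le`. Let `N` be the exceedance set and `q` the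
`η`-quantile of the test residual on `N`. Then `P N ≤ η + P {residual ≥ q}`. Every `z ∈ N` with
residual at most `q` certifies `P {residual ≥ q} ≤ α + errors`; such `z` have mass at least `η`, so
averaging the `z`-dependent error over them costs a factor `1 / η`. Markov's inequality at level `η`
costs another such factor, whence the cube root of the stability.

The DKW-type bound comes from a martingale: along a decreasing chain of sets, the frequencies
divided by the probabilities form one, and a pathwise inequality controls the exponential of its
maximum.

The theorem's `m` corresponds to a swap of `m - 1` points. For the asymptotic part,
`k`-swap-stability is at most `k` times 1-swap-stability, and `k` may grow slowly as the ratio of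
`b` to `γ` vanishes. -/

section MeasurePreserving

/-! ### Exchangeability of i.i.d. samples -/

variable {α : Type*} [MeasurableSpace α] (P : Measure α) [SigmaFinite P] {n : ℕ}

lemma measurePreserving_pi_perm (π : Equiv.Perm (Fin n)) :
    MeasurePreserving (fun (D : Fin n → α) i => D (π i))
      (Measure.pi fun _ : Fin n => P) (Measure.pi fun _ : Fin n => P) := by
  have h := measurePreserving_piCongrLeft (α := fun _ : Fin n => α) (fun _ : Fin n => P) π.symm
  convert h using 1
  funext D i
  simp [MeasurableEquiv.coe_piCongrLeft, Equiv.piCongrLeft_apply]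

lemma measurePreserving_pi_cons :
    MeasurePreserving (fun p : α × (Fin n → α) => (Fin.cons p.1 p.2 : Fin (n + 1) → α))
      (P.prod (Measure.pi fun _ : Fin n => P)) (Measure.pi fun _ : Fin (n + 1) => P) := by
  have h := (measurePreserving_piFinSuccAbove (α := fun _ : Fin (n + 1) => α)
    (fun _ : Fin (n + 1) => P) 0).symm
  convert h using 1
  funext p
  simp [MeasurableEquiv.piFinSuccAbove, Fin.insertNthEquiv]

/-- A fresh point and a sample form `n + 1` i.i.d. coordinates, and the map is a transposition of
them. It serves both to resample one coordinate in the martingale argument and to turn training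
residuals into test residuals. -/
lemma measurePreserving_swap_coord (i : Fin n) :
    MeasurePreserving (fun p : α × (Fin n → α) => (p.2 i, Function.update p.2 i p.1))
      (P.prod (Measure.pi fun _ : Fin n => P)) (P.prod (Measure.pi fun _ : Fin n => P)) := by
  have h₁ := measurePreserving_pi_cons P (n := n)
  have h₂ := measurePreserving_pi_perm P (Equiv.swap (0 : Fin (n + 1)) i.succ)
  have h₃ := measurePreserving_piFinSuccAbove (α := fun _ : Fin (n + 1) => α)
    (fun _ : Fin (n + 1) => P) 0
  have h := h₃.comp (h₂.comp h₁)
  convert h using 1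
  funext p
  refine Prod.ext ?_ ?_
  · simp [MeasurableEquiv.piFinSuccAbove, Fin.insertNthEquiv]
  · funext j
    simp only [MeasurableEquiv.piFinSuccAbove, Fin.insertNthEquiv, Function.comp_apply,
      MeasurableEquiv.coe_mk, Equiv.coe_fn_symm_mk, Fin.removeNth_apply, Fin.succAbove_zero]
    by_cases hj : j = i
    · subst hj; simp
    · rw [Function.update_of_ne hj, Equiv.swap_apply_of_ne_of_ne (Fin.succ_ne_zero j)
        (fun h => hj (Fin.succ_injective _ h))]
      simp

lemma measurePreserving_exchange (p : Fin n → Prop) [DecidablePred p] :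
    MeasurePreserving
      (fun q : (Fin n → α) × (Fin n → α) =>
        ((fun i => if p i then q.1 i else q.2 i : Fin n → α),
          (fun i => if p i then q.2 i else q.1 i : Fin n → α)))
      ((Measure.pi fun _ : Fin n => P).prod (Measure.pi fun _ : Fin n => P))
      ((Measure.pi fun _ : Fin n => P).prod (Measure.pi fun _ : Fin n => P)) := by
  have h := measurePreserving_arrowProdEquivProdArrow α α (Fin n) (fun _ => P) (fun _ => P)
  have h' : MeasurePreserving (fun (x : Fin n → α × α) i => if p i then x i else (x i).swap)
      (Measure.pi fun _ : Fin n => P.prod P) (Measure.pi fun _ : Fin n => P.prod P) := by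
    refine measurePreserving_pi (f := fun i (x : α × α) => if p i then x else x.swap) _ _
      fun i => ?_
    by_cases hi : p i
    · simp only [hi, if_true]
      exact MeasurePreserving.id (P.prod P)
    · simpa [hi] using Measure.measurePreserving_swap (μ := P) (ν := P)
  have h'' := h.comp (h'.comp h.symm)
  convert h'' using 1
  funext q
  refine Prod.ext ?_ ?_ <;> funext i <;> by_cases hi : p i <;>
    simp [MeasurableEquiv.arrowProdEquivProdArrow, Equiv.arrowProdEquivProdArrow, hi]

end MeasurePreserving

/-! ### A pathwise maximal inequality and Hoeffding's bound for one frequency -/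

section MaximalInequality

/-- The right side is a potential: while the running maximum is constant it grows exactly like the
sum, and at a new maximum the tangent-line bound for `exp` makes it grow at least as much. -/
lemma sum_exp_partialSups_mul_le (x : ℕ → ℝ) (K : ℕ) :
    ∑ k ∈ Finset.range K, Real.exp (partialSups x k) * (x (k + 1) - x k) ≤
      Real.exp (partialSups x K) * (x K - partialSups x K + 1) := by
  induction K with
  | zero => simpa using (Real.exp_pos (x 0)).le
  | succ K ih =>
    rw [Finset.sum_range_succ]
    set m := partialSups x K
    have h : partialSups x (K + 1) = max m (x (K + 1)) := partialSups_succ x K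
    rcases le_total (x (K + 1)) m with hle | hle
    · rw [h, max_eq_left hle]; linarith
    · rw [h, max_eq_right hle]
      have h1 : Real.exp (x (K + 1)) = Real.exp m * Real.exp (x (K + 1) - m) := by
        rw [← Real.exp_add]; congr 1; ring
      have h2 := mul_le_mul_of_nonneg_left (Real.add_one_le_exp (x (K + 1) - m)) (Real.exp_pos m).le
      rw [← h1] at h2
      linarith

/-- For a martingale the sum has mean zero, so this is a Doob-type inequality: the exponential of
the maximum has mean at most `e` times that of the exponential of the last term. -/
lemma exp_partialSups_add_sum_le (x : ℕ → ℝ) (K : ℕ) :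
    Real.exp (partialSups x K) +
        ∑ k ∈ Finset.range K, Real.exp (partialSups x k) * (x (k + 1) - x k) ≤
      Real.exp (1 + x K) := by
  have h := sum_exp_partialSups_mul_le x K
  set m := partialSups x K
  have h1 : Real.exp (1 + x K) = Real.exp m * Real.exp (1 + x K - m) := by
    rw [← Real.exp_add]; congr 1; ring
  have h2 := mul_le_mul_of_nonneg_left (Real.add_one_le_exp (1 + x K - m)) (Real.exp_pos m).le
  rw [← h1] at h2
  linarith

variable {α : Type*} [MeasurableSpace α] (P : Measure α) [IsProbabilityMeasure P] {n : ℕ}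

/-- Freezing coordinate `i` at `e` makes the first factor independent of `x i`, so the integral
factors through the mean of `d`. -/
lemma integral_update_mul_eq_zero (i : Fin n) (G : (Fin n → α) → ℝ) (d : α → ℝ)
    (hd0 : ∫ a, d a ∂P = 0) (e : α)
    (hGd : Integrable (fun x => G (Function.update x i e) * d (x i))
      (Measure.pi fun _ : Fin n => P)) :
    ∫ x, G (Function.update x i e) * d (x i) ∂(Measure.pi fun _ : Fin n => P) = 0 := by
  have hmp := measurePreserving_swap_coord P i
  have hmp2 : MeasurePreserving (fun p : α × (Fin n → α) => Function.update p.2 i p.1)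
      (P.prod (Measure.pi fun _ : Fin n => P)) (Measure.pi fun _ : Fin n => P) :=
    measurePreserving_snd.comp hmp
  rw [← hmp2.map_eq] at hGd ⊢
  rw [integral_map hmp2.measurable.aemeasurable hGd.aestronglyMeasurable]
  simp only [Function.update_idem, Function.update_self]
  have := integral_prod_mul (μ := P) (ν := Measure.pi fun _ : Fin n => P) d
    (fun x => G (Function.update x i e))
  simp_rw [mul_comm (d _)] at this
  rw [this, hd0, zero_mul]

/-- The centred, normalized empirical frequency of the set `s` among the coordinates in `I`. -/
noncomputable def normalizedFreq (I : Finset (Fin n)) (s : Set α) (x : Fin n → α) : ℝ :=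
  (∑ i ∈ I, (s.indicator 1 (x i) / P.real s - 1)) / I.card

omit [IsProbabilityMeasure P] in
lemma measurable_normalizedFreq (I : Finset (Fin n)) {s : Set α} (hs : MeasurableSet s) :
    Measurable (normalizedFreq P I s) := by
  unfold normalizedFreq
  refine Measurable.div_const (Finset.measurable_sum _ fun i _ => ?_) _
  exact (((measurable_one.indicator hs).comp (measurable_pi_apply i)).div_const _).sub_const _

omit [IsProbabilityMeasure P] in
lemma indicator_div_sub_one_mem_Icc {s : Set α} (hp : 1 / 2 ≤ P.real s) (a : α) :
    s.indicator (1 : α → ℝ) a / P.real s - 1 ∈ Set.Icc (-1 : ℝ) 1 := by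
  have h0 : 0 < P.real s := by linarith
  by_cases ha : a ∈ s
  · simp only [Set.indicator_of_mem ha, Pi.one_apply, Set.mem_Icc]
    have : 1 / P.real s ≤ 2 := by rw [div_le_iff₀ h0]; linarith
    have h2 : 0 ≤ 1 / P.real s := by positivity
    constructor <;> linarith
  · simp [Set.indicator_of_notMem ha]

omit [IsProbabilityMeasure P] in
lemma abs_normalizedFreq_le {I : Finset (Fin n)} {s : Set α} (hp : 1 / 2 ≤ P.real s)
    (x : Fin n → α) : |normalizedFreq P I s x| ≤ 1 := by
  unfold normalizedFreq
  rw [abs_div, Nat.abs_cast]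
  refine div_le_one_of_le₀ ?_ (Nat.cast_nonneg _)
  refine (Finset.abs_sum_le_sum_abs _ _).trans ?_
  calc _ ≤ ∑ i ∈ I, (1 : ℝ) := Finset.sum_le_sum fun i _ => by
        have := indicator_div_sub_one_mem_Icc P hp (x i)
        exact abs_le.2 ⟨this.1, this.2⟩
    _ = _ := by simp

lemma integral_indicator_div_sub_one {s : Set α} (hs : MeasurableSet s) (hp : 1 / 2 ≤ P.real s) :
    ∫ a, (s.indicator (1 : α → ℝ) a / P.real s - 1) ∂P = 0 := by
  have hi : Integrable (s.indicator (1 : α → ℝ)) P := (integrable_const 1).indicator hs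
  rw [integral_sub (hi.div_const _) (integrable_const _), integral_div, integral_indicator_one hs,
    div_self (by linarith)]
  simp

open ProbabilityTheory in
-- Probability at least `1 / 2` keeps the centred summands in `[-1, 1]`, so each is sub-Gaussian
-- with variance proxy 1.
lemma integral_exp_normalizedFreq_le {I : Finset (Fin n)} (hI : I.Nonempty) {s : Set α}
    (hs : MeasurableSet s) (hp : 1 / 2 ≤ P.real s) (θ : ℝ) :
    ∫ x, Real.exp (θ * normalizedFreq P I s x) ∂(Measure.pi fun _ : Fin n => P) ≤
      Real.exp (θ ^ 2 / (2 * I.card)) := by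
  set μ := Measure.pi fun _ : Fin n => P
  set g : α → ℝ := fun a => s.indicator (1 : α → ℝ) a / P.real s - 1 with hg
  have hgm : Measurable g := ((measurable_one.indicator hs).div_const _).sub_const _
  have hind : iIndepFun (fun (i : Fin n) (x : Fin n → α) => g (x i)) μ :=
    iIndepFun_pi (μ := fun _ : Fin n => P) (X := fun _ => g) fun _ => hgm.aemeasurable
  have hsub : ∀ i ∈ I, HasSubgaussianMGF (fun x : Fin n → α => g (x i)) 1 μ := by
    intro i _
    have hmp : MeasurePreserving (fun x : Fin n → α => x i) μ P :=
      measurePreserving_eval (fun _ : Fin n => P) i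
    have h0 : ∫ x, g (x i) ∂μ = 0 := by
      rw [← integral_map (φ := fun x : Fin n → α => x i) hmp.measurable.aemeasurable
        (f := g) hgm.aestronglyMeasurable, hmp.map_eq]
      exact integral_indicator_div_sub_one P hs hp
    have := hasSubgaussianMGF_of_mem_Icc_of_integral_eq_zero (μ := μ) (a := -1) (b := 1)
      (X := fun x : Fin n → α => g (x i)) (hgm.comp (measurable_pi_apply i)).aemeasurable
      (ae_of_all _ fun x => indicator_div_sub_one_mem_Icc P hp (x i)) h0
    have hc : (‖(1 : ℝ) - -1‖₊ / 2) ^ 2 = 1 := by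
      ext; simp; norm_num
    rwa [hc] at this
  have hsum := HasSubgaussianMGF.sum_of_iIndepFun hind hsub
  have := hsum.mgf_le (θ / I.card)
  have hc : (0 : ℝ) < I.card := by exact_mod_cast hI.card_pos
  unfold mgf at this
  calc _ = ∫ x, Real.exp (θ / I.card * ∑ i ∈ I, g (x i)) ∂μ := by
        refine integral_congr_ae (ae_of_all _ fun x => ?_)
        simp only [normalizedFreq]
        congr 1
        ring
    _ ≤ _ := this
    _ = _ := by
        congr 1
        simp
        field_simp

end MaximalInequality

/-! ### The martingale of frequencies along a decreasing chain -/

section ChainMaximal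

variable {α : Type*} [MeasurableSpace α] (P : Measure α) {n : ℕ}

lemma measurable_partialSups {β : Type*} [MeasurableSpace β] {f : ℕ → β → ℝ}
    (hf : ∀ k, Measurable (f k)) (K : ℕ) :
    Measurable fun x => partialSups (fun k => f k x) K := by
  induction K with
  | zero => simpa using hf 0
  | succ K ih =>
    have : (fun x => partialSups (fun k => f k x) (K + 1)) =
        fun x => max (partialSups (fun k => f k x) K) (f (K + 1) x) :=
      funext fun x => partialSups_succ _ K
    rw [this]
    exact ih.max (hf _)

lemma normalizedFreq_update {I : Finset (Fin n)} {s : Set α} {x : Fin n → α} {i : Fin n} {e : α}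
    (hx : x i ∈ s) (he : e ∈ s) :
    normalizedFreq P I s (Function.update x i e) = normalizedFreq P I s x := by
  unfold normalizedFreq
  congr 1
  refine Finset.sum_congr rfl fun j _ => ?_
  by_cases hj : j = i
  · subst hj; simp [hx, he]
  · simp [Function.update_of_ne hj]

variable [IsProbabilityMeasure P]

/-- Orthogonality of martingale increments. The increment is an average of centred terms `d (x i)`
with `d` zero outside `E k`. Where `x i ∈ E k`, the frequencies up to step `k` do not change when `x
i` is moved within `E k`, so the weight can be frozen in that coordinate. -/
lemma integral_exp_partialSups_mul_eq_zero {I : Finset (Fin n)} {E : ℕ → Set α} (hE : Antitone E)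
    (hEm : ∀ k, MeasurableSet (E k)) (hp : ∀ k, 1 / 2 ≤ P.real (E k)) (θ : ℝ) (k : ℕ) :
    Integrable (fun x => Real.exp (partialSups (fun l => θ * normalizedFreq P I (E l) x) k) *
        (θ * normalizedFreq P I (E (k + 1)) x - θ * normalizedFreq P I (E k) x))
        (Measure.pi fun _ : Fin n => P) ∧
      ∫ x, Real.exp (partialSups (fun l => θ * normalizedFreq P I (E l) x) k) *
        (θ * normalizedFreq P I (E (k + 1)) x - θ * normalizedFreq P I (E k) x)
        ∂(Measure.pi fun _ : Fin n => P) = 0 := by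
  set μ := Measure.pi fun _ : Fin n => P
  set W : (Fin n → α) → ℝ := fun x =>
    Real.exp (partialSups (fun l => θ * normalizedFreq P I (E l) x) k) with hW
  have hWm : Measurable W := Real.measurable_exp.comp
    (measurable_partialSups (fun l => (measurable_normalizedFreq P I (hEm l)).const_mul θ) k)
  have hWb : ∀ x, ‖W x‖ ≤ Real.exp |θ| := by
    intro x
    rw [Real.norm_eq_abs, abs_of_pos (Real.exp_pos _)]
    refine Real.exp_le_exp.2 (partialSups_le _ _ _ fun l _ => ?_)
    refine (le_abs_self _).trans ?_
    rw [abs_mul]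
    exact mul_le_of_le_one_right (abs_nonneg _) (abs_normalizedFreq_le P (hp l) x)
  set d : α → ℝ := fun a =>
    ((E (k + 1)).indicator (1 : α → ℝ) a / P.real (E (k + 1)) - 1) -
      ((E k).indicator (1 : α → ℝ) a / P.real (E k) - 1) with hd
  have hgm : ∀ l, Measurable fun a => (E l).indicator (1 : α → ℝ) a / P.real (E l) - 1 :=
    fun l => ((measurable_one.indicator (hEm l)).div_const _).sub_const _
  have hgi : ∀ l, Integrable (fun a => (E l).indicator (1 : α → ℝ) a / P.real (E l) - 1) P :=
    fun l => Integrable.of_bound (hgm l).aestronglyMeasurable 1 (ae_of_all _ fun a => by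
      have := indicator_div_sub_one_mem_Icc P (hp l) a
      exact abs_le.2 ⟨this.1, this.2⟩)
  have hdm : Measurable d := (hgm _).sub (hgm _)
  have hd0 : ∫ a, d a ∂P = 0 := by
    rw [hd, integral_sub (hgi _) (hgi _), integral_indicator_div_sub_one P (hEm _) (hp _),
      integral_indicator_div_sub_one P (hEm _) (hp _), sub_zero]
  have hdb : ∀ a, ‖d a‖ ≤ 2 := by
    intro a
    have h1 := indicator_div_sub_one_mem_Icc P (hp k) a
    have h2 := indicator_div_sub_one_mem_Icc P (hp (k + 1)) a
    rw [Real.norm_eq_abs, abs_le]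
    constructor <;> simp only [hd] <;> linarith [h1.1, h1.2, h2.1, h2.2]
  obtain ⟨e, he⟩ : (E k).Nonempty := by
    by_contra hne
    have := hp k
    rw [Set.not_nonempty_iff_eq_empty.1 hne, measureReal_empty] at this
    norm_num at this
  have hswap : ∀ i x, W x * d (x i) = W (Function.update x i e) * d (x i) := by
    intro i x
    by_cases hx : x i ∈ E k
    · congr 1
      simp only [hW]
      congr 1
      rw [partialSups_eq_sup'_range, partialSups_eq_sup'_range]
      refine Finset.sup'_congr _ rfl fun l hl => ?_
      have hlk : l ≤ k := Nat.lt_succ_iff.1 (Finset.mem_range.1 hl)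
      rw [normalizedFreq_update P (hE hlk hx) (hE hlk he)]
    · have hx' : x i ∉ E (k + 1) := fun h => hx (hE (Nat.le_succ k) h)
      simp [hd, hx, hx']
  have hint : ∀ i, Integrable (fun x => W x * d (x i)) μ := fun i =>
    Integrable.of_bound (hWm.mul (hdm.comp (measurable_pi_apply i))).aestronglyMeasurable
      (Real.exp |θ| * 2) (ae_of_all _ fun x => by
        rw [norm_mul]
        exact mul_le_mul (hWb x) (hdb _) (norm_nonneg _) (Real.exp_pos _).le)
  have hzero : ∀ i, ∫ x, W x * d (x i) ∂μ = 0 := by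
    intro i
    have h1 := hint i
    simp_rw [hswap i] at h1 ⊢
    exact integral_update_mul_eq_zero P i W d hd0 e h1
  have hrew : (fun x => W x *
      (θ * normalizedFreq P I (E (k + 1)) x - θ * normalizedFreq P I (E k) x)) =
      fun x => ∑ i ∈ I, (θ / I.card) * (W x * d (x i)) := by
    funext x
    simp only [normalizedFreq, hd]
    rw [← Finset.mul_sum, ← Finset.mul_sum]
    simp only [Finset.sum_sub_distrib]
    ring
  rw [hrew]
  refine ⟨integrable_finsetSum _ fun i _ => (hint i).const_mul _, ?_⟩
  rw [integral_finsetSum _ fun i _ => (hint i).const_mul _]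
  refine Finset.sum_eq_zero fun i _ => ?_
  rw [integral_const_mul, hzero, mul_zero]

lemma integral_exp_partialSups_normalizedFreq_le {I : Finset (Fin n)} (hI : I.Nonempty)
    {E : ℕ → Set α} (hE : Antitone E) (hEm : ∀ k, MeasurableSet (E k))
    (hp : ∀ k, 1 / 2 ≤ P.real (E k)) (θ : ℝ) (K : ℕ) :
    ∫⁻ x, ENNReal.ofReal (Real.exp (partialSups (fun l => θ * normalizedFreq P I (E l) x) K))
        ∂(Measure.pi fun _ : Fin n => P) ≤
      ENNReal.ofReal (Real.exp (1 + θ ^ 2 / (2 * I.card))) := by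
  set μ := Measure.pi fun _ : Fin n => P
  have hWm : ∀ k, Measurable fun x =>
      Real.exp (partialSups (fun l => θ * normalizedFreq P I (E l) x) k) := fun k =>
    Real.measurable_exp.comp
      (measurable_partialSups (fun l => (measurable_normalizedFreq P I (hEm l)).const_mul θ) k)
  have hb : ∀ l x, θ * normalizedFreq P I (E l) x ≤ |θ| := fun l x => by
    refine (le_abs_self _).trans ?_
    rw [abs_mul]
    exact mul_le_of_le_one_right (abs_nonneg _) (abs_normalizedFreq_le P (hp l) x)
  have hWi : Integrable (fun x =>
      Real.exp (partialSups (fun l => θ * normalizedFreq P I (E l) x) K)) μ :=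
    Integrable.of_bound (hWm K).aestronglyMeasurable (Real.exp |θ|) (ae_of_all _ fun x => by
      rw [Real.norm_eq_abs, abs_of_pos (Real.exp_pos _)]
      exact Real.exp_le_exp.2 (partialSups_le _ _ _ fun l _ => hb l x))
  have hEi : Integrable (fun x => Real.exp (1 + θ * normalizedFreq P I (E K) x)) μ :=
    Integrable.of_bound (Real.measurable_exp.comp
      (((measurable_normalizedFreq P I (hEm K)).const_mul θ).const_add 1)).aestronglyMeasurable
      (Real.exp (1 + |θ|)) (ae_of_all _ fun x => by
      rw [Real.norm_eq_abs, abs_of_pos (Real.exp_pos _)]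
      exact Real.exp_le_exp.2 (by linarith [hb K x]))
  rw [← ofReal_integral_eq_lintegral_ofReal hWi (ae_of_all _ fun x => (Real.exp_pos _).le)]
  refine ENNReal.ofReal_le_ofReal ?_
  have hz := fun k => integral_exp_partialSups_mul_eq_zero P (I := I) hE hEm hp θ k
  have hsum := integrable_finsetSum (Finset.range K) fun k _ => (hz k).1
  have h1 : ∫ x, (Real.exp (partialSups (fun l => θ * normalizedFreq P I (E l) x) K) +
      ∑ k ∈ Finset.range K, Real.exp (partialSups (fun l => θ * normalizedFreq P I (E l) x) k) *
        (θ * normalizedFreq P I (E (k + 1)) x - θ * normalizedFreq P I (E k) x)) ∂μ ≤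
      ∫ x, Real.exp (1 + θ * normalizedFreq P I (E K) x) ∂μ :=
    integral_mono (hWi.add hsum) hEi fun x =>
      exp_partialSups_add_sum_le (fun l => θ * normalizedFreq P I (E l) x) K
  rw [integral_add hWi hsum, integral_finsetSum _ fun k _ => (hz k).1,
    Finset.sum_eq_zero fun k _ => (hz k).2, add_zero] at h1
  refine h1.trans ?_
  simp_rw [Real.exp_add]
  rw [integral_const_mul]
  exact mul_le_mul_of_nonneg_left (integral_exp_normalizedFreq_le P hI (hEm K) (hp K) θ)
    (Real.exp_pos _).le

/-- A maximal inequality for the normalized frequencies of a decreasing family of sets, each of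
probability at least one half. -/
lemma exists_bound_normalizedFreq {I : Finset (Fin n)} (hI : I.Nonempty)
    {f : ℝ → Set α} (hf : Antitone f) (hfm : ∀ t, MeasurableSet (f t)) (T : Finset ℝ)
    (hp : ∀ t ∈ T, 1 / 2 ≤ P.real (f t)) (θ : ℝ) :
    ∃ Y : (Fin n → α) → ℝ, Measurable Y ∧ (∀ x, 0 ≤ Y x) ∧
      (∀ t ∈ T, ∀ x, θ * normalizedFreq P I (f t) x ≤ Y x) ∧
      ∫⁻ x, ENNReal.ofReal (Real.exp (Y x)) ∂(Measure.pi fun _ : Fin n => P) ≤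
        ENNReal.ofReal (Real.exp (1 + θ ^ 2 / (2 * I.card))) := by
  -- Ranks enumerate `T` increasingly, which turns the family into a chain indexed by `ℕ`. It starts
  -- at the whole space, whose normalized frequency is zero; this gives `0 ≤ Y`.
  set rk : ℝ → ℕ := fun t => (T.filter (· < t)).card with hrk
  set E : ℕ → Set α := fun k => ⋂ t ∈ T.filter (fun t => rk t < k), f t with hEdef
  have hE : Antitone E := fun k l hkl => by
    refine Set.biInter_subset_biInter_left fun t ht => ?_
    simp only [Finset.coe_filter, Set.mem_ofPred_eq] at ht ⊢
    exact ⟨ht.1, ht.2.trans_le hkl⟩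
  have hEm : ∀ k, MeasurableSet (E k) := fun k => Finset.measurableSet_biInter _ fun t _ => hfm t
  have hE0 : E 0 = Set.univ := by simp [hEdef]
  have hEp : ∀ k, 1 / 2 ≤ P.real (E k) := by
    intro k
    rcases (T.filter (fun t => rk t < k)).eq_empty_or_nonempty with h | h
    · simp only [hEdef, h]; simp; norm_num
    · obtain ⟨t, ht, hmax⟩ := Finset.exists_max_image _ id h
      refine (hp t (Finset.mem_filter.1 ht).1).trans (measureReal_mono ?_)
      exact Set.subset_iInter₂ fun s hs => hf (hmax s hs)
  have hEt : ∀ t ∈ T, E (rk t + 1) = f t := by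
    intro t ht
    refine Set.Subset.antisymm (Set.biInter_subset_of_mem (by simp [ht])) ?_
    refine Set.subset_iInter₂ fun s hs => hf ?_
    by_contra hst
    push Not at hst
    have hs' := Finset.mem_filter.1 hs
    have : rk t < rk s := by
      refine Finset.card_lt_card ⟨fun u hu => ?_, fun hsub => ?_⟩
      · simp only [Finset.mem_filter] at hu ⊢
        exact ⟨hu.1, hu.2.trans hst⟩
      · have := hsub (Finset.mem_filter.2 ⟨ht, hst⟩)
        simp at this
    omega
  refine ⟨fun x => partialSups (fun l => θ * normalizedFreq P I (E l) x) (T.card + 1),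
    measurable_partialSups (fun l => (measurable_normalizedFreq P I (hEm l)).const_mul θ) _,
    fun x => ?_, fun t ht x => ?_, integral_exp_partialSups_normalizedFreq_le P hI hE hEm hEp θ _⟩
  · refine le_trans ?_ (le_partialSups_of_le _ (Nat.zero_le _))
    simp [hE0, normalizedFreq]
  · rw [← hEt t ht]
    exact le_partialSups_of_le (fun l => θ * normalizedFreq P I (E l) x)
      (Nat.succ_le_succ (Finset.card_filter_le _ _))

end ChainMaximal

/-! ### A one-sided DKW-type inequality -/

section UpperDeviation

variable {α : Type*} [MeasurableSpace α] (P : Measure α) {n : ℕ}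

/-- The excess of the empirical frequency of `{r < t}` among the coordinates in `I` over its
probability. -/
noncomputable def excessFreq (I : Finset (Fin n)) (r : α → ℝ) (t : ℝ) (x : Fin n → α) : ℝ :=
  (∑ i ∈ I, {a | r a < t}.indicator 1 (x i)) / I.card - P.real {a | r a < t}

/-- The one-sided Kolmogorov distance between the empirical distribution of `r` on the
coordinates in `I` and the distribution of `r`. -/
noncomputable def upperDev (I : Finset (Fin n)) (r : α → ℝ) (x : Fin n → α) : ℝ :=
  ⨆ q : ℚ, max 0 (excessFreq P I r q x)

lemma excessFreq_le_one (I : Finset (Fin n)) (r : α → ℝ) (t : ℝ) (x : Fin n → α) :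
    excessFreq P I r t x ≤ 1 := by
  have h1 : (∑ i ∈ I, {a | r a < t}.indicator (1 : α → ℝ) (x i)) / I.card ≤ 1 := by
    refine div_le_one_of_le₀ ?_ (Nat.cast_nonneg _)
    calc _ ≤ ∑ i ∈ I, (1 : ℝ) :=
          Finset.sum_le_sum fun i _ => Set.indicator_le_self' (fun _ _ => zero_le_one) _
      _ = _ := by simp
  unfold excessFreq
  linarith [measureReal_nonneg (μ := P) (s := {a | r a < t})]

lemma bddAbove_excessFreq (I : Finset (Fin n)) (r : α → ℝ) (x : Fin n → α) :
    BddAbove (Set.range fun q : ℚ => max 0 (excessFreq P I r q x)) :=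
  ⟨1, by rintro _ ⟨q, rfl⟩; exact max_le zero_le_one (excessFreq_le_one P I r q x)⟩

lemma upperDev_nonneg (I : Finset (Fin n)) (r : α → ℝ) (x : Fin n → α) :
    0 ≤ upperDev P I r x :=
  (le_max_left _ _).trans (le_ciSup (bddAbove_excessFreq P I r x) 0)

variable [IsProbabilityMeasure P]

/-- Only finitely many sample values lie below `t`, so a rational slightly below `t` gives the same
empirical frequency and no larger probability. -/
lemma freq_le_add_upperDev (I : Finset (Fin n)) (r : α → ℝ) (t : ℝ) (x : Fin n → α) :
    (∑ i ∈ I, {a | r a < t}.indicator (1 : α → ℝ) (x i)) / I.card ≤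
      P.real {a | r a < t} + upperDev P I r x := by
  obtain ⟨u, hut, hu⟩ : ∃ u < t, ∀ i, r (x i) < t → r (x i) ≤ u := by
    rcases (Finset.univ.filter fun i => r (x i) < t).eq_empty_or_nonempty with h | h
    · refine ⟨t - 1, by linarith, fun i hi => ?_⟩
      have : i ∈ Finset.univ.filter fun i => r (x i) < t := by simp [hi]
      simp [h] at this
    · obtain ⟨j, hj, hmax⟩ := Finset.exists_max_image _ (fun i => r (x i)) h
      exact ⟨r (x j), (Finset.mem_filter.1 hj).2, fun i hi => hmax i (by simp [hi])⟩
  obtain ⟨q, huq, hqt⟩ := exists_rat_btwn hut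
  have h1 : (∑ i ∈ I, {a | r a < t}.indicator (1 : α → ℝ) (x i)) =
      ∑ i ∈ I, {a | r a < (q : ℝ)}.indicator (1 : α → ℝ) (x i) := by
    refine Finset.sum_congr rfl fun i _ => ?_
    by_cases hi : r (x i) < t
    · simp [hi, (hu i hi).trans_lt huq]
    · have : ¬ r (x i) < q := fun h => hi (h.trans hqt)
      simp [hi, this]
  have h2 := (le_max_right _ _).trans (le_ciSup (bddAbove_excessFreq P I r x) q)
  have h3 : P.real {a | r a < (q : ℝ)} ≤ P.real {a | r a < t} :=
    measureReal_mono fun a (ha : r a < q) => ha.trans hqt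
  rw [h1]
  unfold upperDev
  unfold excessFreq at h2 ⊢
  linarith

omit [IsProbabilityMeasure P] in
lemma measurable_excessFreq (I : Finset (Fin n)) {r : α → ℝ} (hr : Measurable r) (t : ℝ) :
    Measurable (excessFreq P I r t) := by
  refine ((Finset.measurable_sum _ fun i _ => ?_).div_const _).sub_const _
  exact (measurable_one.indicator (measurableSet_lt hr measurable_const)).comp
    (measurable_pi_apply i)

omit [IsProbabilityMeasure P] in
lemma excessFreq_eq_mul_normalizedFreq {I : Finset (Fin n)} (hI : I.Nonempty) (r : α → ℝ) (t : ℝ)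
    (x : Fin n → α) (hp : 1 / 2 ≤ P.real {a | r a < t}) :
    excessFreq P I r t x = P.real {a | r a < t} * normalizedFreq P I {a | r a < t} x := by
  have hc : (0 : ℝ) < I.card := by exact_mod_cast hI.card_pos
  have h0 : P.real {a | r a < t} ≠ 0 := by linarith
  unfold excessFreq normalizedFreq
  rw [Finset.sum_sub_distrib, ← Finset.sum_div]
  simp only [Finset.sum_const, nsmul_eq_mul, mul_one]
  field_simp

lemma excessFreq_eq_neg_mul_normalizedFreq {I : Finset (Fin n)} (hI : I.Nonempty) {r : α → ℝ}
    (hr : Measurable r) (t : ℝ) (x : Fin n → α) (hp : 1 / 2 ≤ P.real {a | t ≤ r a}) :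
    excessFreq P I r t x = -(P.real {a | t ≤ r a} * normalizedFreq P I {a | t ≤ r a} x) := by
  have hc : (0 : ℝ) < I.card := by exact_mod_cast hI.card_pos
  have h0 : P.real {a | t ≤ r a} ≠ 0 := by linarith
  have hcompl : {a | r a < t} = {a | t ≤ r a}ᶜ := by ext; simp
  have hm : MeasurableSet {a | t ≤ r a} := measurableSet_le measurable_const hr
  unfold excessFreq normalizedFreq
  rw [hcompl, probReal_compl_eq_one_sub hm, Finset.sum_sub_distrib, ← Finset.sum_div]
  have : ∀ i, ({a | t ≤ r a}ᶜ).indicator (1 : α → ℝ) (x i) =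
      1 - {a | t ≤ r a}.indicator (1 : α → ℝ) (x i) := fun i => by
    by_cases hi : t ≤ r (x i) <;> simp [hi]
  simp only [this, Finset.sum_sub_distrib, Finset.sum_const, nsmul_eq_mul, mul_one]
  field_simp
  ring

/-- For each `t`, the set `{t ≤ r}` or its complement has probability at least `1 / 2`. The two
cases use two chains, and adding the two bounds produces the factor 2. -/
lemma exists_bound_excessFreq {I : Finset (Fin n)} (hI : I.Nonempty) {r : α → ℝ}
    (hr : Measurable r) {c : ℝ} (hc : 0 ≤ c) (T : Finset ℝ) :
    ∃ Y : (Fin n → α) → ℝ≥0∞, (∀ t ∈ T, ∀ x,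
        ENNReal.ofReal (Real.exp (c * max 0 (excessFreq P I r t x))) ≤ Y x) ∧
      ∫⁻ x, Y x ∂(Measure.pi fun _ : Fin n => P) ≤
        2 * ENNReal.ofReal (Real.exp (1 + c ^ 2 / (2 * I.card))) := by
  obtain ⟨Y₁, hY₁m, hY₁0, hY₁, hY₁i⟩ := exists_bound_normalizedFreq P hI
    (f := fun t => {a | t ≤ r a}) (fun s t hst a (ha : t ≤ r a) => hst.trans ha)
    (fun t => measurableSet_le measurable_const hr)
    (T.filter fun t => 1 / 2 ≤ P.real {a | t ≤ r a}) (fun t ht => (Finset.mem_filter.1 ht).2) (-c)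
  -- The sets `{r < t}` increase with `t`; the sign change makes the family decreasing.
  obtain ⟨Y₂, hY₂m, hY₂0, hY₂, hY₂i⟩ := exists_bound_normalizedFreq P hI
    (f := fun t => {a | r a < -t}) (fun s t hst a (ha : r a < -t) => by
      show r a < -s; linarith)
    (fun t => measurableSet_lt hr measurable_const)
    ((T.filter fun t => 1 / 2 ≤ P.real {a | r a < t}).image (fun t => -t))
    (fun t ht => by
      obtain ⟨s, hs, rfl⟩ := Finset.mem_image.1 ht
      simpa using (Finset.mem_filter.1 hs).2) c
  refine ⟨fun x => ENNReal.ofReal (Real.exp (Y₁ x)) + ENNReal.ofReal (Real.exp (Y₂ x)),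
    fun t ht x => ?_, ?_⟩
  · by_cases hp : 1 / 2 ≤ P.real {a | t ≤ r a}
    · refine le_trans (ENNReal.ofReal_le_ofReal (Real.exp_le_exp.2 ?_)) le_self_add
      have h1 := hY₁ t (Finset.mem_filter.2 ⟨ht, hp⟩) x
      have hp1 : P.real {a | t ≤ r a} ≤ 1 := measureReal_le_one
      rw [mul_max_of_nonneg _ _ hc, mul_zero, excessFreq_eq_neg_mul_normalizedFreq P hI hr t x hp]
      refine max_le (hY₁0 x) ?_
      nlinarith [hY₁0 x]
    · have hm : MeasurableSet {a | t ≤ r a} := measurableSet_le measurable_const hr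
      have hp' : 1 / 2 ≤ P.real {a | r a < t} := by
        have hcompl : {a | r a < t} = {a | t ≤ r a}ᶜ := by ext; simp
        rw [hcompl, probReal_compl_eq_one_sub hm]
        linarith
      refine le_trans (ENNReal.ofReal_le_ofReal (Real.exp_le_exp.2 ?_)) le_add_self
      have h1 := hY₂ (-t) (Finset.mem_image_of_mem _ (Finset.mem_filter.2 ⟨ht, hp'⟩)) x
      have hp1 : P.real {a | r a < t} ≤ 1 := measureReal_le_one
      simp only [neg_neg] at h1
      rw [mul_max_of_nonneg _ _ hc, mul_zero, excessFreq_eq_mul_normalizedFreq P hI r t x hp']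
      refine max_le (hY₂0 x) ?_
      nlinarith [hY₂0 x]
  · rw [lintegral_add_left (by fun_prop), two_mul]
    rw [neg_sq] at hY₁i
    exact add_le_add hY₁i hY₂i

/-- A one-sided Dvoretzky–Kiefer–Wolfowitz type inequality for the moment generating function. -/
lemma lintegral_exp_upperDev_le {I : Finset (Fin n)} (hI : I.Nonempty) {r : α → ℝ}
    (hr : Measurable r) {c : ℝ} (hc : 0 ≤ c) :
    ∫⁻ x, ENNReal.ofReal (Real.exp (c * upperDev P I r x)) ∂(Measure.pi fun _ : Fin n => P) ≤
      2 * ENNReal.ofReal (Real.exp (1 + c ^ 2 / (2 * I.card))) := by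
  have hmono : Monotone fun y : ℝ => ENNReal.ofReal (Real.exp (c * y)) := fun y z hyz =>
    ENNReal.ofReal_le_ofReal (Real.exp_le_exp.2 (mul_le_mul_of_nonneg_left hyz hc))
  have hcont : Continuous fun y : ℝ => ENNReal.ofReal (Real.exp (c * y)) :=
    ENNReal.continuous_ofReal.comp (by fun_prop)
  have hsup : ∀ x, ENNReal.ofReal (Real.exp (c * upperDev P I r x)) =
      ⨆ T : Finset ℚ, ⨆ q ∈ T,
        ENNReal.ofReal (Real.exp (c * max 0 (excessFreq P I r (q : ℝ) x))) := fun x => by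
    rw [← iSup_eq_iSup_finset]
    exact hmono.map_ciSup_of_continuousAt hcont.continuousAt (bddAbove_excessFreq P I r x)
  -- The bound for finitely many thresholds does not depend on their number, so monotone convergence
  -- carries it to all rationals.
  simp_rw [hsup]
  rw [lintegral_iSup_directed]
  · refine iSup_le fun T => ?_
    classical
    obtain ⟨Y, hY, hYi⟩ := exists_bound_excessFreq P hI hr hc (T.image fun q : ℚ => (q : ℝ))
    refine le_trans (lintegral_mono fun x => ?_) hYi
    exact iSup₂_le fun q hq => hY q (Finset.mem_image_of_mem _ hq) x
  · intro T
    refine Measurable.aemeasurable (Measurable.iSup fun q => Measurable.iSup fun _ => ?_)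
    exact (hcont.measurable).comp (measurable_const.max (measurable_excessFreq P I hr q))
  · refine Monotone.directed_le fun S T hST x => ?_
    exact biSup_mono fun q hq => hST hq

end UpperDeviation

/-! ### Residuals and the symmetry of the algorithm -/

section Residuals

variable {𝒳 : Type u} [MeasurableSpace 𝒳] (A : RegressionAlgorithm 𝒳) {n : ℕ}

/-- The residual at the test point `z` of the model fitted on `D` and `z`. -/
noncomputable def testResidual (D : Fin n → 𝒳 × ℝ) (z : 𝒳 × ℝ) : ℝ :=
  |z.2 - augmentedFit A D z.1 z.2 z.1|

/-- The residual at the training point `D i` of the model fitted on `D` and `z`. -/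
noncomputable def trainResidual (D : Fin n → 𝒳 × ℝ) (z : 𝒳 × ℝ) (i : Fin n) : ℝ :=
  |(D i).2 - augmentedFit A D z.1 z.2 (D i).1|

/-- The change of the test residual when the last `m` training points are replaced. -/
noncomputable def residualGap (m : ℕ) (z : 𝒳 × ℝ) (D D' : Fin n → 𝒳 × ℝ) : ℝ :=
  |testResidual A D z - testResidual A (swapLast m D D') z|

lemma augmentedFit_eq_cons (D : Fin n → 𝒳 × ℝ) (z : 𝒳 × ℝ) :
    augmentedFit A D z.1 z.2 = A.fit (n + 1) (Fin.cons z D : Fin (n + 1) → 𝒳 × ℝ) := by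
  unfold augmentedFit
  rw [Fin.snoc_eq_cons_rotate]
  exact A.fit_perm (n + 1) (finRotate (n + 1)) (Fin.cons z D : Fin (n + 1) → 𝒳 × ℝ)

lemma augmentedFit_perm (D : Fin n → 𝒳 × ℝ) (π : Equiv.Perm (Fin n)) (z : 𝒳 × ℝ) :
    augmentedFit A (fun i => D (π i)) z.1 z.2 = augmentedFit A D z.1 z.2 := by
  rw [augmentedFit_eq_cons, augmentedFit_eq_cons,
    ← A.fit_perm (n + 1) (Equiv.Perm.decomposeFin.symm (0, π)) (Fin.cons z D)]
  congr 1
  funext i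
  refine Fin.cases ?_ (fun i => ?_) i
  · simp
  · simp [Equiv.Perm.decomposeFin_symm_apply_succ]

lemma testResidual_perm (D : Fin n → 𝒳 × ℝ) (π : Equiv.Perm (Fin n)) (z : 𝒳 × ℝ) :
    testResidual A (fun i => D (π i)) z = testResidual A D z := by
  unfold testResidual
  rw [augmentedFit_perm]

lemma trainResidual_perm (D : Fin n → 𝒳 × ℝ) (π : Equiv.Perm (Fin n)) (z : 𝒳 × ℝ) (i : Fin n) :
    trainResidual A (fun i => D (π i)) z i = trainResidual A D z (π i) := by
  unfold trainResidual
  rw [augmentedFit_perm]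

/-- Both models are fitted on the same `n + 1` points; only the roles of `z` and `D i` are
exchanged. -/
lemma testResidual_update (D : Fin n → 𝒳 × ℝ) (z : 𝒳 × ℝ) (i : Fin n) :
    testResidual A (Function.update D i z) (D i) = trainResidual A D z i := by
  unfold testResidual trainResidual
  rw [augmentedFit_eq_cons, augmentedFit_eq_cons, ← A.fit_perm (n + 1) (Equiv.swap 0 i.succ)
    (Fin.cons z D)]
  congr 4
  funext j
  refine Fin.cases ?_ (fun j => ?_) j
  · simp
  · by_cases hj : j = i
    · subst hj; simp
    · rw [Equiv.swap_apply_of_ne_of_ne (Fin.succ_ne_zero j) (fun h => hj (Fin.succ_injective _ h))]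
      simp [hj]

omit [MeasurableSpace 𝒳] in
lemma swapLast_update (m : ℕ) (D D' : Fin n → 𝒳 × ℝ) (z : 𝒳 × ℝ) {i : Fin n}
    (hi : n - m ≤ (i : ℕ)) : swapLast m (Function.update D i z) D' = swapLast m D D' := by
  funext j
  unfold swapLast
  split_ifs with h
  · rw [Function.update_of_ne]
    rintro rfl
    omega
  · rfl

lemma residualGap_update (m : ℕ) (D D' : Fin n → 𝒳 × ℝ) (z : 𝒳 × ℝ) {i : Fin n}
    (hi : n - m ≤ (i : ℕ)) : residualGap A m (D i) (Function.update D i z) D' =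
      |trainResidual A D z i - testResidual A (swapLast m D D') (D i)| := by
  unfold residualGap
  rw [testResidual_update, swapLast_update m D D' z hi]

lemma measurable_cons_pair : Measurable fun p : (Fin n → 𝒳 × ℝ) × (𝒳 × ℝ) =>
    (Fin.cons p.2 p.1 : Fin (n + 1) → 𝒳 × ℝ) := by
  refine measurable_pi_iff.2 fun i => ?_
  refine Fin.cases ?_ (fun i => ?_) i
  · simpa using measurable_snd
  · simp only [Fin.cons_succ]
    exact (measurable_pi_apply i).comp measurable_fst

lemma measurable_swapLast (m : ℕ) : Measurable fun p : (Fin n → 𝒳 × ℝ) × (Fin n → 𝒳 × ℝ) =>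
    swapLast m p.1 p.2 := by
  refine measurable_pi_iff.2 fun i => ?_
  unfold swapLast
  split_ifs
  · exact (measurable_pi_apply i).comp measurable_fst
  · exact (measurable_pi_apply i).comp measurable_snd

lemma measurable_testResidual : Measurable fun p : (Fin n → 𝒳 × ℝ) × (𝒳 × ℝ) =>
    testResidual A p.1 p.2 := by
  unfold testResidual
  simp_rw [augmentedFit_eq_cons]
  have h := (A.measurable_fit (n + 1)).comp (measurable_cons_pair.prodMk
    (measurable_fst.comp measurable_snd : Measurable fun p : (Fin n → 𝒳 × ℝ) × (𝒳 × ℝ) => p.2.1))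
  exact ((measurable_snd.comp measurable_snd).sub h).abs

lemma measurable_trainResidual (i : Fin n) : Measurable fun p : (Fin n → 𝒳 × ℝ) × (𝒳 × ℝ) =>
    trainResidual A p.1 p.2 i := by
  unfold trainResidual
  simp_rw [augmentedFit_eq_cons]
  have hi : Measurable fun p : (Fin n → 𝒳 × ℝ) × (𝒳 × ℝ) => p.1 i :=
    (measurable_pi_apply i).comp measurable_fst
  have h := (A.measurable_fit (n + 1)).comp (measurable_cons_pair.prodMk hi.fst)
  exact (hi.snd.sub h).abs

lemma measurable_residualGap (m : ℕ) :
    Measurable fun p : ((𝒳 × ℝ) × (Fin n → 𝒳 × ℝ)) × (Fin n → 𝒳 × ℝ) =>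
      residualGap A m p.1.1 p.1.2 p.2 := by
  unfold residualGap
  have h := measurable_testResidual A (n := n)
  have hs := measurable_swapLast (𝒳 := 𝒳) (n := n) m
  have h1 : Measurable fun p : ((𝒳 × ℝ) × (Fin n → 𝒳 × ℝ)) × (Fin n → 𝒳 × ℝ) =>
      (p.1.2, p.1.1) := by fun_prop
  have h2 : Measurable fun p : ((𝒳 × ℝ) × (Fin n → 𝒳 × ℝ)) × (Fin n → 𝒳 × ℝ) =>
      (swapLast m p.1.2 p.2, p.1.1) :=
    (hs.comp (by fun_prop : Measurable fun p : ((𝒳 × ℝ) × (Fin n → 𝒳 × ℝ)) × (Fin n → 𝒳 × ℝ) =>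
      (p.1.2, p.2))).prodMk (by fun_prop)
  exact ((h.comp h1).sub (h.comp h2)).abs

lemma measurable_fit_swapLast_sub (m : ℕ) (i : Fin n) :
    Measurable fun p : (Fin n → 𝒳 × ℝ) × (Fin n → 𝒳 × ℝ) =>
      ENNReal.ofReal |A.fit n p.1 (p.1 i).1 - A.fit n (swapLast m p.1 p.2) (p.1 i).1| := by
  have hi : Measurable fun p : (Fin n → 𝒳 × ℝ) × (Fin n → 𝒳 × ℝ) => (p.1 i).1 :=
    ((measurable_pi_apply i).comp measurable_fst).fst
  have h1 := (A.measurable_fit n).comp (measurable_fst.prodMk hi)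
  have h2 := (A.measurable_fit n).comp ((measurable_swapLast m).prodMk hi)
  exact (h1.sub h2).abs.ennreal_ofReal

end Residuals

/-! ### Swap-stability -/

section Stability

variable {𝒳 : Type u} [MeasurableSpace 𝒳] (A : RegressionAlgorithm 𝒳)
  (P : Measure (𝒳 × ℝ)) [IsProbabilityMeasure P] {n : ℕ}

instance isProbabilityMeasure_iidLaw : IsProbabilityMeasure (iidLaw P n) := by
  unfold iidLaw; infer_instance

lemma measurePreserving_swapLast (m : ℕ) :
    MeasurePreserving (fun q : (Fin n → 𝒳 × ℝ) × (Fin n → 𝒳 × ℝ) =>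
        (swapLast m q.1 q.2, swapLast m q.2 q.1))
      ((iidLaw P n).prod (iidLaw P n)) ((iidLaw P n).prod (iidLaw P n)) :=
  measurePreserving_exchange P fun i : Fin n => (i : ℕ) < n - m

/-- By symmetry the test point may be placed at index 0, which is never swapped and is where
in-sample stability is evaluated. -/
lemma lintegral_residualGap_le (m : ℕ) (hm : m < n + 1) :
    ∫⁻ q : ((𝒳 × ℝ) × (Fin n → 𝒳 × ℝ)) × (Fin n → 𝒳 × ℝ),
        ENNReal.ofReal (residualGap A m q.1.1 q.1.2 q.2)
        ∂((P.prod (iidLaw P n)).prod (iidLaw P n)) ≤ inSwapStability A P m (n + 1) hm := by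
  have hcons : MeasurePreserving
      (fun p : (𝒳 × ℝ) × (Fin n → 𝒳 × ℝ) => (Fin.cons p.1 p.2 : Fin (n + 1) → 𝒳 × ℝ))
      (P.prod (iidLaw P n)) (iidLaw P (n + 1)) := measurePreserving_pi_cons P
  have h1 := hcons.prod hcons
  have h2 : MeasurePreserving (Prod.map id Prod.snd :
      ((𝒳 × ℝ) × (Fin n → 𝒳 × ℝ)) × ((𝒳 × ℝ) × (Fin n → 𝒳 × ℝ)) → _)
      ((P.prod (iidLaw P n)).prod (P.prod (iidLaw P n)))
      ((P.prod (iidLaw P n)).prod (iidLaw P n)) :=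
    (MeasurePreserving.id _).prod measurePreserving_snd
  unfold inSwapStability
  rw [← h1.lintegral_comp (measurable_fit_swapLast_sub A m _),
    ← h2.lintegral_comp (measurable_residualGap A m).ennreal_ofReal]
  refine lintegral_mono fun q => ENNReal.ofReal_le_ofReal ?_
  obtain ⟨⟨z, D⟩, z', D'⟩ := q
  have hs : (Fin.cons z (swapLast m D D') : Fin (n + 1) → 𝒳 × ℝ) =
      swapLast m (Fin.cons z D : Fin (n + 1) → 𝒳 × ℝ) (Fin.cons z' D') := by
    funext i
    unfold swapLast
    refine Fin.cases ?_ (fun i => ?_) i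
    · have : 0 < n + 1 - m := by omega
      simp [this]
    · have : (i : ℕ) + 1 < n + 1 - m ↔ (i : ℕ) < n - m := by omega
      simp [this]
  simp only [residualGap, testResidual, augmentedFit_eq_cons, Prod.map_apply, id]
  rw [hs]
  refine (abs_abs_sub_abs_le _ _).trans ?_
  rw [abs_sub_comm]
  apply le_of_eq
  congr 1
  simp

lemma inSwapStability_zero (h : 0 < n) : inSwapStability A P 0 n h = 0 := by
  unfold inSwapStability
  have : ∀ D D' : Fin n → 𝒳 × ℝ, swapLast 0 D D' = D := fun D D' => by
    funext i; simp [swapLast]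
  simp [this]

/-- Triangle inequality through the data set with `k` points swapped. The permutation `σ` brings the
next point to be swapped into last position and fixes index 0, so the second difference is a 1-swap
of an i.i.d. sample. -/
lemma inSwapStability_succ_le (k : ℕ) (h : k + 1 < n) :
    inSwapStability A P (k + 1) n h ≤
      inSwapStability A P k n (by omega) + inSwapStability A P 1 n (by omega) := by
  set σ : Equiv.Perm (Fin n) := Equiv.swap ⟨n - (k + 1), by omega⟩ ⟨n - 1, by omega⟩ with hσ
  have hperm : MeasurePreserving (fun (D : Fin n → 𝒳 × ℝ) i => D (σ i)) (iidLaw P n)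
      (iidLaw P n) := measurePreserving_pi_perm P σ
  have hmp := (hperm.prod hperm).comp (measurePreserving_swapLast P (n := n) k)
  have hm1 := measurable_fit_swapLast_sub A 1 (⟨0, by omega⟩ : Fin n)
  unfold inSwapStability
  rw [← hmp.lintegral_comp hm1, ← lintegral_add_left (measurable_fit_swapLast_sub A k _)]
  refine lintegral_mono fun q => ?_
  rw [← ENNReal.ofReal_add (abs_nonneg _) (abs_nonneg _)]
  refine ENNReal.ofReal_le_ofReal ?_
  simp only [Function.comp_apply, Prod.map_apply]
  have hσ0 : σ ⟨0, by omega⟩ = ⟨0, by omega⟩ := by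
    refine Equiv.swap_apply_of_ne_of_ne ?_ ?_ <;> simp only [ne_eq, Fin.mk.injEq] <;> omega
  have hs0 : swapLast k q.1 q.2 ⟨0, by omega⟩ = q.1 ⟨0, by omega⟩ := by
    unfold swapLast
    rw [if_pos]
    show 0 < n - k
    omega
  have hfit : (swapLast 1 (fun i => swapLast k q.1 q.2 (σ i)) fun i => swapLast k q.2 q.1 (σ i)) =
      fun i => swapLast (k + 1) q.1 q.2 (σ i) := by
    funext i
    by_cases hi : i = ⟨n - 1, by omega⟩
    · have : σ i = ⟨n - (k + 1), by omega⟩ := by rw [hi]; exact Equiv.swap_apply_right _ _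
      unfold swapLast
      have hlt : n - (k + 1) < n - k := by omega
      simp only [this, lt_irrefl, if_false, hlt, if_true]
      rw [if_neg (by rw [hi]; simp)]
    · have hi' : (i : ℕ) < n - 1 := by
        have := i.2
        have : (i : ℕ) ≠ n - 1 := fun h => hi (Fin.ext h)
        omega
      have hne : (σ i : ℕ) ≠ n - (k + 1) := by
        intro hc
        have h2 : σ i = σ ⟨n - 1, by omega⟩ := by
          rw [hσ, Equiv.swap_apply_right]; exact Fin.ext hc
        exact hi (σ.injective h2)
      have hiff : (σ i : ℕ) < n - k ↔ (σ i : ℕ) < n - (k + 1) := by omega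
      simp [swapLast, hi', hiff]
  rw [hfit, A.fit_perm n σ, A.fit_perm n σ, hσ0, hs0]
  exact abs_sub_le _ _ _

lemma inSwapStability_le_mul (k : ℕ) (h : k < n) (hn : 1 < n) :
    inSwapStability A P k n h ≤ k * inSwapStability A P 1 n hn := by
  induction k with
  | zero => simp [inSwapStability_zero]
  | succ k ih =>
    refine (inSwapStability_succ_le A P k h).trans ?_
    rw [Nat.cast_succ, add_mul, one_mul]
    gcongr
    exact ih (by omega)

end Stability

/-! ### Ramp functions -/

section Ramp

/-- The function that decreases linearly from `1` at `q - γ` to `0` at `q`. -/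
noncomputable def ramp (q γ u : ℝ) : ℝ≥0∞ := ENNReal.ofReal (min 1 ((q - u) / γ))

lemma measurable_ramp (q γ : ℝ) : Measurable (ramp q γ) := by
  unfold ramp; fun_prop

/-- With `ramp_le`, this sandwiches the ramp between two indicators, up to its Lipschitz constant `1
/ γ` times the perturbation. -/
lemma one_le_ramp_add {q γ u v : ℝ} (hγ : 0 < γ) (hv : v < q - γ) :
    1 ≤ ramp q γ u + ENNReal.ofReal |v - u| / ENNReal.ofReal γ := by
  rw [← ENNReal.ofReal_div_of_pos hγ, ← ENNReal.ofReal_one]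
  refine le_trans (ENNReal.ofReal_le_ofReal ?_) ENNReal.ofReal_add_le
  have h0 : 0 ≤ |v - u| / γ := by positivity
  rw [← min_add_add_right]
  refine le_min (by linarith) ?_
  rw [← add_div, le_div_iff₀ hγ]
  linarith [neg_abs_le (v - u)]

lemma ramp_le {q γ u v : ℝ} (hγ : 0 < γ) (hv : q ≤ v) :
    ramp q γ u ≤ ENNReal.ofReal |v - u| / ENNReal.ofReal γ := by
  rw [← ENNReal.ofReal_div_of_pos hγ]
  refine ENNReal.ofReal_le_ofReal ((min_le_right _ _).trans ?_)
  gcongr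
  linarith [le_abs_self (v - u)]

lemma ramp_le_one (q γ u : ℝ) : ramp q γ u ≤ 1 := by
  unfold ramp
  rw [← ENNReal.ofReal_one]
  exact ENNReal.ofReal_le_ofReal (min_le_left _ _)

/-- A ramp is a mixture of indicators of half-lines, so the uniform deviation bound passes to it
without loss. -/
lemma ramp_eq_lintegral {q γ u : ℝ} (hγ : 0 < γ) :
    ramp q γ u = ∫⁻ y in Set.Ioo (0 : ℝ) 1, {y : ℝ | u < q - y * γ}.indicator 1 y := by
  have hm : MeasurableSet {y : ℝ | u < q - y * γ} :=
    measurableSet_lt measurable_const (by fun_prop)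
  rw [lintegral_indicator_one hm, Measure.restrict_apply hm]
  have : {y : ℝ | u < q - y * γ} ∩ Set.Ioo 0 1 = Set.Ioo 0 (min 1 ((q - u) / γ)) := by
    ext y
    simp only [Set.mem_inter_iff, Set.mem_ofPred_eq, Set.mem_Ioo, lt_min_iff, lt_div_iff₀ hγ]
    constructor
    · rintro ⟨h1, h2, h3⟩; exact ⟨h2, h3, by linarith⟩
    · rintro ⟨h1, h2, h3⟩; exact ⟨by linarith, h1, h2⟩
  rw [this, Real.volume_Ioo, sub_zero, ramp]

variable {α : Type*} [MeasurableSpace α] (P : Measure α) [IsProbabilityMeasure P] {n : ℕ}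

lemma freq_le_add_ofReal_upperDev {I : Finset (Fin n)} (hI : I.Nonempty) (r : α → ℝ) (t : ℝ)
    (x : Fin n → α) :
    (∑ i ∈ I, {a | r a < t}.indicator (1 : α → ℝ≥0∞) (x i)) / (I.card : ℝ≥0∞) ≤
      P {a | r a < t} + ENNReal.ofReal (upperDev P I r x) := by
  have hc : (0 : ℝ) < I.card := by exact_mod_cast hI.card_pos
  have h := ENNReal.ofReal_le_ofReal (freq_le_add_upperDev P I r t x)
  rw [ENNReal.ofReal_add measureReal_nonneg (upperDev_nonneg P I r x), ofReal_measureReal,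
    ENNReal.ofReal_div_of_pos hc, ENNReal.ofReal_natCast] at h
  convert h using 2
  have h0 : ∀ i ∈ I, 0 ≤ {a | r a < t}.indicator (1 : α → ℝ) (x i) := fun i _ =>
    Set.indicator_nonneg (fun _ _ => zero_le_one) _
  rw [ENNReal.ofReal_sum_of_nonneg h0]
  refine Finset.sum_congr rfl fun i _ => ?_
  by_cases hi : r (x i) < t <;> simp [hi]

lemma ramp_freq_le {I : Finset (Fin n)} (hI : I.Nonempty) {r : α → ℝ} (hr : Measurable r)
    (q : ℝ) {γ : ℝ} (hγ : 0 < γ) (x : Fin n → α) :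
    (∑ i ∈ I, ramp q γ (r (x i))) / (I.card : ℝ≥0∞) ≤
      ∫⁻ a, ramp q γ (r a) ∂P + ENNReal.ofReal (upperDev P I r x) := by
  have hm : ∀ u : ℝ, Measurable fun y : ℝ => {y : ℝ | u < q - y * γ}.indicator (1 : ℝ → ℝ≥0∞) y :=
    fun u => measurable_one.indicator (measurableSet_lt measurable_const (by fun_prop))
  have hset : MeasurableSet {p : ℝ × α | r p.2 < q - p.1 * γ} :=
    measurableSet_lt (by fun_prop) (by fun_prop)
  have h1 : (∑ i ∈ I, ramp q γ (r (x i))) / (I.card : ℝ≥0∞) =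
      ∫⁻ y in Set.Ioo (0 : ℝ) 1,
        (∑ i ∈ I, {a | r a < q - y * γ}.indicator (1 : α → ℝ≥0∞) (x i)) / (I.card : ℝ≥0∞) := by
    simp_rw [div_eq_mul_inv]
    have hsw : ∀ (y : ℝ) (a : α), {a | r a < q - y * γ}.indicator (1 : α → ℝ≥0∞) a =
        {y : ℝ | r a < q - y * γ}.indicator (1 : ℝ → ℝ≥0∞) y := fun y a => by
      by_cases h : r a < q - y * γ <;> simp [h]
    simp_rw [hsw]
    rw [lintegral_mul_const _ (Finset.measurable_sum _ fun i _ => hm _),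
      lintegral_finsetSum _ fun i _ => hm _]
    simp_rw [ramp_eq_lintegral hγ]
  have h2 : ∫⁻ a, ramp q γ (r a) ∂P =
      ∫⁻ y in Set.Ioo (0 : ℝ) 1, P {a | r a < q - y * γ} := by
    simp_rw [ramp_eq_lintegral hγ]
    have hsw := lintegral_lintegral_swap (μ := P) (ν := volume.restrict (Set.Ioo (0 : ℝ) 1))
      (f := fun a y => {y : ℝ | r a < q - y * γ}.indicator (1 : ℝ → ℝ≥0∞) y) ?_
    · rw [hsw]
      refine lintegral_congr fun y => ?_
      rw [← lintegral_indicator_one (measurableSet_lt hr measurable_const)]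
      refine lintegral_congr fun a => ?_
      by_cases h : r a < q - y * γ <;> simp [h]
    · have : (Function.uncurry fun (a : α) (y : ℝ) =>
          {y : ℝ | r a < q - y * γ}.indicator (1 : ℝ → ℝ≥0∞) y) =
          {p : α × ℝ | r p.1 < q - p.2 * γ}.indicator 1 := by
        funext p
        by_cases h : r p.1 < q - p.2 * γ <;> simp [Function.uncurry, h]
      rw [this]
      exact (measurable_one.indicator (measurableSet_lt (by fun_prop) (by fun_prop))).aemeasurable
  rw [h1, h2]
  calc _ ≤ ∫⁻ y in Set.Ioo (0 : ℝ) 1,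
        (P {a | r a < q - y * γ} + ENNReal.ofReal (upperDev P I r x)) :=
        lintegral_mono fun y => freq_le_add_ofReal_upperDev P hI r _ x
    _ = _ := by rw [lintegral_add_right _ measurable_const]; simp

end Ramp

/-! ### Quantiles of finite measures -/

section Quantile

variable {α : Type*} [MeasurableSpace α]

lemma exists_quantile (ν : Measure α) [IsFiniteMeasure ν] {r : α → ℝ} (hr : Measurable r)
    {η : ℝ≥0∞} (h0 : 0 < η) (h1 : η < ν Set.univ) :
    ∃ q : ℝ, η ≤ ν {a | r a ≤ q} ∧ ν {a | r a < q} ≤ η := by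
  set ρ := ν.map r
  have hle : ∀ t, ν {a | r a ≤ t} = ρ (Set.Iic t) := fun t =>
    (Measure.map_apply hr measurableSet_Iic).symm
  have hlt : ∀ t, ν {a | r a < t} = ρ (Set.Iio t) := fun t =>
    (Measure.map_apply hr measurableSet_Iio).symm
  have huniv : ρ Set.univ = ν Set.univ := Measure.map_apply hr MeasurableSet.univ
  simp_rw [hle, hlt]
  set s : Set ℝ := {t | η ≤ ρ (Set.Iic t)} with hs
  have hne : s.Nonempty := by
    have := tendsto_measure_Iic_atTop ρ
    rw [huniv] at this
    obtain ⟨t, ht⟩ := ((tendsto_order.1 this).1 η h1).exists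
    exact ⟨t, ht.le⟩
  have hbdd : BddBelow s := by
    have := tendsto_measure_iInter_atTop (μ := ρ) (s := fun k : ℕ => Set.Iic (-(k : ℝ)))
      (fun k => measurableSet_Iic.nullMeasurableSet)
      (fun i j hij => Set.Iic_subset_Iic.2 (neg_le_neg (Nat.cast_le.2 hij)))
      ⟨0, measure_ne_top _ _⟩
    have hempty : ⋂ k : ℕ, Set.Iic (-(k : ℝ)) = ∅ := by
      refine Set.eq_empty_of_forall_notMem fun y hy => ?_
      obtain ⟨k, hk⟩ := exists_nat_gt (-y)
      have := Set.mem_iInter.1 hy k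
      simp only [Set.mem_Iic] at this
      linarith
    rw [hempty, measure_empty] at this
    obtain ⟨k, ht⟩ := ((tendsto_order.1 this).2 η h0).exists
    refine ⟨-(k : ℝ), fun u hu => ?_⟩
    by_contra hut
    push Not at hut
    exact absurd (hu.trans (measure_mono (Set.Iic_subset_Iic.2 hut.le))) (not_le.2 ht)
  refine ⟨sInf s, ?_, ?_⟩
  · obtain ⟨u, hu_anti, hu_gt, hu_tend⟩ := exists_seq_strictAnti_tendsto (sInf s)
    have hI : Set.Iic (sInf s) = ⋂ k, Set.Iic (u k) := by
      ext y
      simp only [Set.mem_Iic, Set.mem_iInter]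
      exact ⟨fun h k => h.trans (hu_gt k).le, fun h => ge_of_tendsto' hu_tend h⟩
    have ht := tendsto_measure_iInter_atTop (μ := ρ) (s := fun k => Set.Iic (u k))
      (fun k => measurableSet_Iic.nullMeasurableSet)
      (fun i j hij => Set.Iic_subset_Iic.2 (hu_anti.antitone hij)) ⟨0, measure_ne_top _ _⟩
    rw [← hI] at ht
    refine ge_of_tendsto' ht fun k => ?_
    obtain ⟨t, ht, htk⟩ := exists_lt_of_csInf_lt hne (hu_gt k)
    exact le_trans ht (measure_mono (Set.Iic_subset_Iic.2 htk.le))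
  · obtain ⟨u, hu_mono, hu_lt, hu_tend⟩ := exists_seq_strictMono_tendsto (sInf s)
    have hU : Set.Iio (sInf s) = ⋃ k, Set.Iic (u k) := by
      ext y
      simp only [Set.mem_Iio, Set.mem_iUnion, Set.mem_Iic]
      constructor
      · intro h
        obtain ⟨k, hk⟩ := ((tendsto_order.1 hu_tend).1 y h).exists
        exact ⟨k, hk.le⟩
      · rintro ⟨k, hk⟩; exact hk.trans_lt (hu_lt k)
    have ht := tendsto_measure_iUnion_atTop (μ := ρ) (s := fun k => Set.Iic (u k))
      (fun i j hij => Set.Iic_subset_Iic.2 (hu_mono.monotone hij))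
    rw [← hU] at ht
    refine le_of_tendsto' ht fun k => ?_
    by_contra hk
    push Not at hk
    exact absurd (csInf_le hbdd (show u k ∈ s from hk.le)) (not_le.2 (hu_lt k))

end Quantile

/-! ### The deterministic bound on the exceedance set -/

noncomputable section

section LastIndices

/-- The last `m` indices. -/
def lastIdx (n m : ℕ) : Finset (Fin n) := Finset.univ.filter fun i => n - m ≤ (i : ℕ)

lemma card_lastIdx {n m : ℕ} (h : m ≤ n) : (lastIdx n m).card = m := by
  have h1 : (lastIdx n m).card = ((Finset.range n).filter fun i => n - m ≤ i).card := by
    rw [lastIdx, ← Finset.card_map Fin.valEmbedding]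
    congr 1
    ext i
    simp only [Finset.mem_map, Finset.mem_filter, Finset.mem_univ, true_and, Fin.valEmbedding_apply,
      Finset.mem_range]
    exact ⟨by rintro ⟨j, hj, rfl⟩; exact ⟨j.2, hj⟩, fun ⟨h, h'⟩ => ⟨⟨i, h⟩, h', rfl⟩⟩
  have h2 : (Finset.range n).filter (fun i => n - m ≤ i) = Finset.Ico (n - m) n := by
    ext i; simp [and_comm]
  rw [h1, h2, Nat.card_Ico]
  omega

end LastIndices

section Shift

variable {n : ℕ} [NeZero n]

/-- The data set `D`, cyclically shifted by `j`. -/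
def cyclicShift {β : Type*} (j : Fin n) (D : Fin n → β) : Fin n → β :=
  fun i => D (Equiv.addRight j i)

/-- For fixed `i`, the shifted index runs once through all indices. -/
lemma sum_sum_cyclicShift {M : Type*} [AddCommMonoid M] (I : Finset (Fin n)) (g : Fin n → M) :
    ∑ j, ∑ i ∈ I, cyclicShift j g i = I.card • ∑ i, g i := by
  rw [Finset.sum_comm, ← Finset.sum_const]
  exact Finset.sum_congr rfl fun i _ => Equiv.sum_comp (Equiv.addLeft i) g

end Shift

section Miscoverage

variable {𝒳 : Type u} [MeasurableSpace 𝒳] (A : RegressionAlgorithm 𝒳) {n : ℕ}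

/-- The test points whose residual exceeds by more than `γ` a fraction `1 - α` of the training
residuals. -/
def exceedSet (α γ : ℝ) (D : Fin n → 𝒳 × ℝ) : Set (𝒳 × ℝ) :=
  {z | ENNReal.ofReal (1 - α) ≤
    (∑ i, if trainResidual A D z i < testResidual A D z - γ then 1 else 0) / (n : ℝ≥0∞)}

lemma mem_exceedSet_of_notMem_conformalSet (hn : 0 < n) {α γ : ℝ} (hα : α ≤ 1)
    {D : Fin n → 𝒳 × ℝ} {z : 𝒳 × ℝ} (hz : z.2 ∉ conformalSet A α γ D z.1) :
    z ∈ exceedSet A α γ D := by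
  have hn' : (0 : ℝ) < n := by exact_mod_cast hn
  simp only [conformalSet, Set.mem_ofPred_eq, not_le] at hz
  have hz' : empQuantile (fun i : Fin n => |(D i).2 - augmentedFit A D z.1 z.2 (D i).1|)
      ((1 - α) * (1 + 1 / (n : ℝ))) < ((testResidual A D z - γ : ℝ) : EReal) := by
    rw [EReal.coe_sub]
    refine EReal.lt_sub_iff_add_lt (Or.inl (EReal.coe_ne_bot _)) (Or.inl (EReal.coe_ne_top _)) |>.2 ?_
    exact hz
  obtain ⟨t, ht⟩ := iInf_lt_iff.1 hz'
  obtain ⟨hτ, ht⟩ := iInf_lt_iff.1 ht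
  have ht := EReal.coe_lt_coe_iff.1 ht
  have h1 : 1 - α ≤ (1 - α) * (1 + 1 / (n : ℝ)) :=
    le_mul_of_one_le_right (by linarith) (by have : 0 ≤ 1 / (n : ℝ) := by positivity
                                             linarith)
  have h2 := ENNReal.ofReal_le_ofReal (h1.trans hτ)
  rw [ENNReal.ofReal_div_of_pos hn', ENNReal.ofReal_natCast, ENNReal.ofReal_natCast] at h2
  refine h2.trans ?_
  gcongr
  rw [Finset.sum_boole, Nat.card_eq_fintype_card, Fintype.card_subtype]
  exact_mod_cast Finset.card_le_card fun i hi => by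
    simp only [Finset.mem_filter, Finset.mem_univ, true_and] at hi ⊢
    exact hi.trans_lt ht

lemma measurableSet_exceedSet_prod (α γ : ℝ) :
    MeasurableSet {p : (Fin n → 𝒳 × ℝ) × (𝒳 × ℝ) | p.2 ∈ exceedSet A α γ p.1} := by
  unfold exceedSet
  have h : Measurable fun p : (Fin n → 𝒳 × ℝ) × (𝒳 × ℝ) =>
      ∑ i, if trainResidual A p.1 p.2 i < testResidual A p.1 p.2 - γ then (1 : ℝ≥0∞) else 0 := by
    refine Finset.measurable_sum _ fun i _ => Measurable.ite ?_ measurable_const measurable_const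
    exact measurableSet_lt (measurable_trainResidual A i)
      ((measurable_testResidual A).sub_const γ)
  exact measurableSet_le measurable_const (h.div_const _)

lemma measurableSet_exceedSet (α γ : ℝ) (D : Fin n → 𝒳 × ℝ) :
    MeasurableSet (exceedSet A α γ D) :=
  (measurable_const.prodMk measurable_id : Measurable fun z : 𝒳 × ℝ => (D, z))
    (measurableSet_exceedSet_prod A α γ)

variable (P : Measure (𝒳 × ℝ)) [IsProbabilityMeasure P]

lemma miscoverage_le (hn : 0 < n) {α γ : ℝ} (hα : α ≤ 1) (D : Fin n → 𝒳 × ℝ) :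
    ENNReal.ofReal (miscoverage A P α γ D) ≤ P (exceedSet A α γ D) := by
  unfold miscoverage
  rw [ofReal_measureReal]
  exact measure_mono fun z hz => mem_exceedSet_of_notMem_conformalSet A hn hα hz

/-- The one-sided Kolmogorov distance between the test residuals, after replacing the last `m`
training points, at these points and their distribution. -/
def swapDev (m : ℕ) (D D' : Fin n → 𝒳 × ℝ) : ℝ :=
  upperDev P (lastIdx n m) (testResidual A (swapLast m D D')) D

/-- The average change of the test residual at an independent test point. -/
def testGap (m : ℕ) (γ : ℝ) (D D' : Fin n → 𝒳 × ℝ) : ℝ≥0∞ :=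
  ∫⁻ w, ENNReal.ofReal (residualGap A m w D D') / ENNReal.ofReal γ ∂P

/-- The average change of the residuals at the last `m` training points. -/
def trainGap (m : ℕ) (γ : ℝ) (D D' : Fin n → 𝒳 × ℝ) (z : 𝒳 × ℝ) : ℝ≥0∞ :=
  (∑ i ∈ lastIdx n m, ENNReal.ofReal (residualGap A m (D i) (Function.update D i z) D') /
    ENNReal.ofReal γ) / (m : ℝ≥0∞)

/-- Chain of comparisons: training residuals below `q - γ` are bounded by the ramp of `r` plus
`trainGap`; the empirical mean of the ramp by its integral plus `swapDev`; the integral by the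
probability of a test residual below `q` plus `testGap`. -/
lemma exceed_freq_add_le {m : ℕ} (hm : 1 ≤ m) (hmn : m ≤ n) {γ : ℝ} (hγ : 0 < γ)
    (D D' : Fin n → 𝒳 × ℝ) {z : 𝒳 × ℝ} {q : ℝ} (hz : testResidual A D z ≤ q) :
    (∑ i ∈ lastIdx n m, if trainResidual A D z i < testResidual A D z - γ then 1 else 0) /
        (m : ℝ≥0∞) + P {w | q ≤ testResidual A D w} ≤
      1 + ENNReal.ofReal (swapDev A P m D D') + testGap A P m γ D D' + trainGap A m γ D D' z := by
  set r := testResidual A (swapLast m D D') with hrdef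
  have hmeas : ∀ D : Fin n → 𝒳 × ℝ, Measurable (testResidual A D) := fun D =>
    (measurable_testResidual A).comp (measurable_const.prodMk measurable_id)
  have hr : Measurable r := hmeas _
  have hI : (lastIdx n m).Nonempty := Finset.card_pos.1 (by rw [card_lastIdx hmn]; exact hm)
  have h1 : (∑ i ∈ lastIdx n m, if trainResidual A D z i < testResidual A D z - γ then 1 else 0) /
      (m : ℝ≥0∞) ≤ (∑ i ∈ lastIdx n m, ramp q γ (r (D i))) / (m : ℝ≥0∞) +
        trainGap A m γ D D' z := by
    unfold trainGap
    rw [← ENNReal.add_div, ← Finset.sum_add_distrib]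
    gcongr with i hi
    split_ifs with h
    · rw [residualGap_update A m D D' z (Finset.mem_filter.1 hi).2]
      exact one_le_ramp_add hγ (by linarith)
    · exact bot_le
  have h2 := ramp_freq_le P hI hr q hγ D
  rw [card_lastIdx hmn] at h2
  have h3 : ∫⁻ a, ramp q γ (r a) ∂P + P {w | q ≤ testResidual A D w} ≤
      1 + testGap A P m γ D D' := by
    have hs : MeasurableSet {w | q ≤ testResidual A D w} :=
      measurableSet_le measurable_const (hmeas D)
    rw [← lintegral_indicator_one hs, ← lintegral_add_left (show Measurable fun a => ramp q γ (r a) from (measurable_ramp q γ).comp hr)]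
    have : (1 : ℝ≥0∞) = ∫⁻ _, 1 ∂P := by simp
    unfold testGap
    rw [this, ← lintegral_add_left measurable_const]
    refine lintegral_mono fun w => ?_
    by_cases hw : q ≤ testResidual A D w
    · simp only [Set.indicator, Set.mem_ofPred_eq, hw, if_true, Pi.one_apply]
      rw [add_comm]
      gcongr
      exact ramp_le hγ hw
    · simp only [Set.indicator, Set.mem_ofPred_eq, hw, if_false, add_zero]
      exact (ramp_le_one _ _ _).trans le_self_add
  calc _ ≤ ((∫⁻ a, ramp q γ (r a) ∂P + ENNReal.ofReal (swapDev A P m D D')) +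
        trainGap A m γ D D' z) + P {w | q ≤ testResidual A D w} := by
        gcongr
        exact h1.trans (by gcongr; exact h2)
    _ = (∫⁻ a, ramp q γ (r a) ∂P + P {w | q ≤ testResidual A D w}) +
        ENNReal.ofReal (swapDev A P m D D') + trainGap A m γ D D' z := by ring
    _ ≤ (1 + testGap A P m γ D D') + ENNReal.ofReal (swapDev A P m D D') +
        trainGap A m γ D D' z := by gcongr
    _ = _ := by ring

variable [NeZero n]

lemma exceed_freq_eq {m : ℕ} (hm : 1 ≤ m) (hmn : m ≤ n) (γ : ℝ) (D : Fin n → 𝒳 × ℝ)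
    (z : 𝒳 × ℝ) :
    (∑ i, if trainResidual A D z i < testResidual A D z - γ then 1 else 0) / (n : ℝ≥0∞) =
      (∑ j, (∑ i ∈ lastIdx n m, if trainResidual A (cyclicShift j D) z i <
        testResidual A (cyclicShift j D) z - γ then 1 else 0) / (m : ℝ≥0∞)) / (n : ℝ≥0∞) := by
  have hm0 : (m : ℝ≥0∞) ≠ 0 := by simp; omega
  congr 1
  have h := sum_sum_cyclicShift (lastIdx n m) fun i : Fin n =>
    if trainResidual A D z i < testResidual A D z - γ then (1 : ℝ≥0∞) else 0
  rw [card_lastIdx hmn, nsmul_eq_mul] at h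
  simp_rw [div_eq_mul_inv]
  rw [← Finset.sum_mul]
  have h' : ∀ j : Fin n, (∑ i ∈ lastIdx n m, if trainResidual A (cyclicShift j D) z i <
        testResidual A (cyclicShift j D) z - γ then (1 : ℝ≥0∞) else 0) =
      ∑ i ∈ lastIdx n m, cyclicShift j (fun i : Fin n =>
        if trainResidual A D z i < testResidual A D z - γ then (1 : ℝ≥0∞) else 0) i := fun j => by
    refine Finset.sum_congr rfl fun i _ => ?_
    unfold cyclicShift
    rw [trainResidual_perm, testResidual_perm]
  simp_rw [h']
  rw [h, mul_comm (m : ℝ≥0∞), mul_assoc, ENNReal.mul_inv_cancel hm0 (ENNReal.natCast_ne_top m),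
    mul_one]

/-- The deterministic bound on the probability of the exceedance set. -/
lemma measure_exceedSet_add_le {m : ℕ} (hm : 1 ≤ m) (hmn : m ≤ n) {α γ : ℝ} (hα : 0 ≤ α)
    (hγ : 0 < γ) (D D' : Fin n → 𝒳 × ℝ) {η : ℝ≥0∞} (hη : 0 < η) (hη' : η ≠ ∞) :
    P (exceedSet A α γ D) + ENNReal.ofReal (1 - α) ≤
      η + 1 + (∑ j, ENNReal.ofReal (swapDev A P m (cyclicShift j D) D')) / (n : ℝ≥0∞) +
        (∑ j, testGap A P m γ (cyclicShift j D) D') / (n : ℝ≥0∞) +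
        (∑ j, ∫⁻ z, trainGap A m γ (cyclicShift j D) D' z ∂P) / (n : ℝ≥0∞) / η := by
  have hn0 : (n : ℝ≥0∞) ≠ 0 := by simp [NeZero.ne n]
  have hnt : (n : ℝ≥0∞) ≠ ∞ := ENNReal.natCast_ne_top n
  set N := exceedSet A α γ D with hN
  have hNm : MeasurableSet N := measurableSet_exceedSet A α γ D
  have hrm : Measurable (testResidual A D) :=
    (measurable_testResidual A).comp (measurable_const.prodMk measurable_id)
  have hα1 : ENNReal.ofReal (1 - α) ≤ 1 := by
    rw [← ENNReal.ofReal_one]; exact ENNReal.ofReal_le_ofReal (by linarith)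
  -- If `P N ≤ η` the claim is trivial; otherwise `N` has enough mass for an `η`-quantile of the
  -- residual on it.
  by_cases hcase : P N ≤ η
  · refine (add_le_add hcase hα1).trans ?_
    rw [add_assoc (η + 1), add_assoc (η + 1)]
    exact le_self_add
  push Not at hcase
  obtain ⟨q, hq1, hq2⟩ := exists_quantile (P.restrict N) hrm hη (by simpa using hcase)
  rw [Measure.restrict_apply (measurableSet_le hrm measurable_const)] at hq1
  rw [Measure.restrict_apply (measurableSet_lt hrm measurable_const)] at hq2
  set N₀ := {a | testResidual A D a ≤ q} ∩ N
  set p₁ := P {w | q ≤ testResidual A D w} with hp₁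
  have hPN : P N ≤ η + p₁ := by
    calc P N ≤ P (({a | testResidual A D a < q} ∩ N) ∪ {w | q ≤ testResidual A D w}) := by
          refine measure_mono fun w hw => ?_
          rcases lt_or_ge (testResidual A D w) q with h | h
          · exact Or.inl ⟨h, hw⟩
          · exact Or.inr h
      _ ≤ _ := (measure_union_le _ _).trans (by gcongr)
  set S := (∑ j, ENNReal.ofReal (swapDev A P m (cyclicShift j D) D')) / (n : ℝ≥0∞)
  set E₁ := (∑ j, testGap A P m γ (cyclicShift j D) D') / (n : ℝ≥0∞)
  set e₂ : 𝒳 × ℝ → ℝ≥0∞ := fun z =>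
    (∑ j, trainGap A m γ (cyclicShift j D) D' z) / (n : ℝ≥0∞) with he₂
  have havg : ∀ c : ℝ≥0∞, (∑ _j : Fin n, c) / (n : ℝ≥0∞) = c := fun c => by
    rw [Finset.sum_const, Finset.card_univ, Fintype.card_fin, nsmul_eq_mul, mul_comm,
      ENNReal.mul_div_cancel_right hn0 hnt]
  have hkey : ∀ z ∈ N₀, ENNReal.ofReal (1 - α) + p₁ ≤ 1 + S + E₁ + e₂ z := by
    rintro z ⟨hzq, hzN⟩
    have h1 : ENNReal.ofReal (1 - α) ≤ _ := hzN
    rw [exceed_freq_eq A hm hmn] at h1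
    calc _ ≤ (∑ j, ((∑ i ∈ lastIdx n m, if trainResidual A (cyclicShift j D) z i <
          testResidual A (cyclicShift j D) z - γ then 1 else 0) / (m : ℝ≥0∞) + p₁)) /
            (n : ℝ≥0∞) := by
          rw [Finset.sum_add_distrib, ENNReal.add_div, havg]
          gcongr
      _ ≤ (∑ j, (1 + ENNReal.ofReal (swapDev A P m (cyclicShift j D) D') +
          testGap A P m γ (cyclicShift j D) D' + trainGap A m γ (cyclicShift j D) D' z)) /
            (n : ℝ≥0∞) := by
          refine ENNReal.div_le_div_right (Finset.sum_le_sum fun j _ => ?_) _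
          have hperm : testResidual A (cyclicShift j D) = testResidual A D :=
            funext fun w => testResidual_perm A D _ w
          rw [hp₁, ← hperm]
          exact exceed_freq_add_le A P hm hmn hγ _ D' (by rw [hperm]; exact hzq)
      _ = _ := by
          simp only [Finset.sum_add_distrib, ENNReal.add_div, havg, S, E₁, he₂]
  have htm : ∀ j, Measurable (trainGap A m γ (cyclicShift j D) D') := by
    intro j
    unfold trainGap
    refine Measurable.div_const (Finset.measurable_sum _ fun i _ => Measurable.div_const ?_ _) _
    refine ((measurable_residualGap A m).comp (?_ : Measurable fun z : 𝒳 × ℝ =>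
      ((cyclicShift j D i, Function.update (cyclicShift j D) i z), D'))).ennreal_ofReal
    exact (measurable_const.prodMk (measurable_update _)).prodMk measurable_const
  have hE₂ : ∫⁻ z, e₂ z ∂P =
      (∑ j, ∫⁻ z, trainGap A m γ (cyclicShift j D) D' z ∂P) / (n : ℝ≥0∞) := by
    simp only [he₂, div_eq_mul_inv]
    rw [lintegral_mul_const _ (Finset.measurable_sum _ fun j _ => htm j),
      lintegral_finsetSum _ fun j _ => htm j]
  rw [← hE₂]
  have hN₀m : MeasurableSet N₀ := (measurableSet_le hrm measurable_const).inter hNm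
  -- `hkey` bounds `e₂` from below on `N₀`, whose mass is at least `η` by the choice of `q`.
  have hint : (ENNReal.ofReal (1 - α) + p₁ - (1 + S + E₁)) * η ≤ ∫⁻ z, e₂ z ∂P := by
    calc _ ≤ (ENNReal.ofReal (1 - α) + p₁ - (1 + S + E₁)) * P N₀ := by gcongr
      _ = ∫⁻ z in N₀, (ENNReal.ofReal (1 - α) + p₁ - (1 + S + E₁)) ∂P := by simp
      _ ≤ ∫⁻ z in N₀, e₂ z ∂P := setLIntegral_mono' hN₀m fun z hz =>
          tsub_le_iff_left.2 (hkey z hz)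
      _ ≤ _ := setLIntegral_le_lintegral _ _
  have hfin : ENNReal.ofReal (1 - α) + p₁ ≤ 1 + S + E₁ + (∫⁻ z, e₂ z ∂P) / η := by
    rw [← tsub_le_iff_left, ENNReal.le_div_iff_mul_le (Or.inl hη.ne') (Or.inl hη')]
    exact hint
  calc _ ≤ η + p₁ + ENNReal.ofReal (1 - α) := by gcongr
    _ = η + (ENNReal.ofReal (1 - α) + p₁) := by ring
    _ ≤ η + (1 + S + E₁ + (∫⁻ z, e₂ z ∂P) / η) := by gcongr
    _ = _ := by ring

end Miscoverage

end

/-! ### Means of the gaps and tails of the deviation -/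

section Expectations

variable {𝒳 : Type u} [MeasurableSpace 𝒳] (A : RegressionAlgorithm 𝒳)
  (P : Measure (𝒳 × ℝ)) [IsProbabilityMeasure P] {n : ℕ}

lemma measurePreserving_reorder : MeasurePreserving
    (fun p : ((Fin n → 𝒳 × ℝ) × (Fin n → 𝒳 × ℝ)) × (𝒳 × ℝ) => ((p.2, p.1.1), p.1.2))
    (((iidLaw P n).prod (iidLaw P n)).prod P) ((P.prod (iidLaw P n)).prod (iidLaw P n)) :=
  (measurePreserving_prodAssoc P (iidLaw P n) (iidLaw P n)).symm.comp
    Measure.measurePreserving_swap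

lemma measurable_residualGap_reorder (m : ℕ) (γ : ℝ) : Measurable
    fun p : ((Fin n → 𝒳 × ℝ) × (Fin n → 𝒳 × ℝ)) × (𝒳 × ℝ) =>
      ENNReal.ofReal (residualGap A m p.2 p.1.1 p.1.2) / ENNReal.ofReal γ :=
  ((measurable_residualGap A m).comp (by fun_prop : Measurable
    fun p : ((Fin n → 𝒳 × ℝ) × (Fin n → 𝒳 × ℝ)) × (𝒳 × ℝ) =>
      ((p.2, p.1.1), p.1.2))).ennreal_ofReal.div_const _

lemma measurable_residualGap_update (m : ℕ) (γ : ℝ) (i : Fin n) : Measurable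
    fun p : ((Fin n → 𝒳 × ℝ) × (Fin n → 𝒳 × ℝ)) × (𝒳 × ℝ) =>
      ENNReal.ofReal (residualGap A m (p.1.1 i) (Function.update p.1.1 i p.2) p.1.2) /
        ENNReal.ofReal γ := by
  have hu : Measurable fun p : ((Fin n → 𝒳 × ℝ) × (Fin n → 𝒳 × ℝ)) × (𝒳 × ℝ) =>
      Function.update p.1.1 i p.2 := by
    refine measurable_pi_iff.2 fun k => ?_
    by_cases hk : k = i
    · subst hk; simpa using measurable_snd
    · simp only [Function.update_of_ne hk]; fun_prop
  exact ((measurable_residualGap A m).comp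
    (((by fun_prop : Measurable fun p : ((Fin n → 𝒳 × ℝ) × (Fin n → 𝒳 × ℝ)) × (𝒳 × ℝ) =>
      p.1.1 i).prodMk hu).prodMk (by fun_prop : Measurable
      fun p : ((Fin n → 𝒳 × ℝ) × (Fin n → 𝒳 × ℝ)) × (𝒳 × ℝ) =>
      p.1.2))).ennreal_ofReal.div_const _

lemma lintegral_residualGap_div_le (m : ℕ) (hm : m < n + 1) (γ : ℝ) :
    ∫⁻ q : ((𝒳 × ℝ) × (Fin n → 𝒳 × ℝ)) × (Fin n → 𝒳 × ℝ),
        ENNReal.ofReal (residualGap A m q.1.1 q.1.2 q.2) / ENNReal.ofReal γ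
        ∂((P.prod (iidLaw P n)).prod (iidLaw P n)) ≤
      inSwapStability A P m (n + 1) hm / ENNReal.ofReal γ := by
  simp_rw [div_eq_mul_inv]
  rw [lintegral_mul_const _ (measurable_residualGap A m).ennreal_ofReal]
  gcongr
  exact lintegral_residualGap_le A P m hm

lemma lintegral_testGap_le (m : ℕ) (hm : m < n + 1) (γ : ℝ) :
    ∫⁻ p : (Fin n → 𝒳 × ℝ) × (Fin n → 𝒳 × ℝ), testGap A P m γ p.1 p.2
        ∂((iidLaw P n).prod (iidLaw P n)) ≤
      inSwapStability A P m (n + 1) hm / ENNReal.ofReal γ := by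
  unfold testGap
  rw [← lintegral_prod _ (measurable_residualGap_reorder A m γ).aemeasurable]
  refine le_trans (le_of_eq ?_) (lintegral_residualGap_div_le A P m hm γ)
  exact (measurePreserving_reorder P).lintegral_comp
    ((measurable_residualGap A m).ennreal_ofReal.div_const _)

/-- Exchanging `z` with `D i` preserves the law and turns each summand into the gap at an
independent test point. -/
lemma lintegral_trainGap_le {m : ℕ} (hm0 : 1 ≤ m) (hm : m < n + 1) (γ : ℝ) :
    ∫⁻ p : (Fin n → 𝒳 × ℝ) × (Fin n → 𝒳 × ℝ), ∫⁻ z, trainGap A m γ p.1 p.2 z ∂P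
        ∂((iidLaw P n).prod (iidLaw P n)) ≤
      inSwapStability A P m (n + 1) hm / ENNReal.ofReal γ := by
  have hmeas := measurable_residualGap_update A (n := n) m γ
  unfold trainGap
  rw [← lintegral_prod (fun p : ((Fin n → 𝒳 × ℝ) × (Fin n → 𝒳 × ℝ)) × (𝒳 × ℝ) =>
    (∑ i ∈ lastIdx n m, ENNReal.ofReal (residualGap A m (p.1.1 i)
      (Function.update p.1.1 i p.2) p.1.2) / ENNReal.ofReal γ) / (m : ℝ≥0∞))
    (Measurable.div_const (Finset.measurable_sum _ fun i _ => hmeas i) _).aemeasurable]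
  have hm0' : (m : ℝ≥0∞) ≠ 0 := by simp; omega
  have hone : ∀ i : Fin n, ∫⁻ p : ((Fin n → 𝒳 × ℝ) × (Fin n → 𝒳 × ℝ)) × (𝒳 × ℝ),
      ENNReal.ofReal (residualGap A m (p.1.1 i) (Function.update p.1.1 i p.2) p.1.2) /
        ENNReal.ofReal γ ∂(((iidLaw P n).prod (iidLaw P n)).prod P) ≤
      inSwapStability A P m (n + 1) hm / ENNReal.ofReal γ := fun i => by
    refine le_trans (le_of_eq ?_) (lintegral_residualGap_div_le A P m hm γ)
    have hsw : MeasurePreserving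
        (fun p : (𝒳 × ℝ) × (Fin n → 𝒳 × ℝ) => (p.2 i, Function.update p.2 i p.1))
        (P.prod (iidLaw P n)) (P.prod (iidLaw P n)) := measurePreserving_swap_coord P i
    exact ((hsw.prod (MeasurePreserving.id (iidLaw P n))).comp
      (measurePreserving_reorder P)).lintegral_comp
      ((measurable_residualGap A m).ennreal_ofReal.div_const _)
  simp_rw [div_eq_mul_inv _ (m : ℝ≥0∞)]
  rw [lintegral_mul_const _ (Finset.measurable_sum _ fun i _ => hmeas i),
    lintegral_finsetSum _ fun i _ => hmeas i, ← div_eq_mul_inv]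
  refine ENNReal.div_le_of_le_mul ?_
  refine (Finset.sum_le_card_nsmul _ _ _ fun i _ => hone i).trans ?_
  rw [card_lastIdx (by omega), nsmul_eq_mul, mul_comm]

lemma measurable_testGap (m : ℕ) (γ : ℝ) : Measurable
    fun p : (Fin n → 𝒳 × ℝ) × (Fin n → 𝒳 × ℝ) => testGap A P m γ p.1 p.2 :=
  (measurable_residualGap_reorder A m γ).lintegral_prod_right'

lemma measurable_lintegral_trainGap (m : ℕ) (γ : ℝ) : Measurable
    fun p : (Fin n → 𝒳 × ℝ) × (Fin n → 𝒳 × ℝ) => ∫⁻ z, trainGap A m γ p.1 p.2 z ∂P := by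
  have hmeas := measurable_residualGap_update A (n := n) m γ
  have : Measurable fun p : ((Fin n → 𝒳 × ℝ) × (Fin n → 𝒳 × ℝ)) × (𝒳 × ℝ) =>
      trainGap A m γ p.1.1 p.1.2 p.2 :=
    Measurable.div_const (Finset.measurable_sum _ fun i _ => hmeas i) _
  exact this.lintegral_prod_right'

lemma measurable_upperDev_testResidual (I : Finset (Fin n)) : Measurable
    fun p : (Fin n → 𝒳 × ℝ) × (Fin n → 𝒳 × ℝ) => upperDev P I (testResidual A p.1) p.2 := by
  unfold upperDev
  refine Measurable.iSup fun q => measurable_const.max ?_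
  unfold excessFreq
  refine Measurable.sub (Measurable.div_const (Finset.measurable_sum _ fun i _ => ?_) _) ?_
  · have hm : MeasurableSet {p : (Fin n → 𝒳 × ℝ) × (𝒳 × ℝ) | testResidual A p.1 p.2 < (q : ℝ)} :=
      measurableSet_lt (measurable_testResidual A) measurable_const
    have h1 : Measurable ({p : (Fin n → 𝒳 × ℝ) × (𝒳 × ℝ) |
        testResidual A p.1 p.2 < (q : ℝ)}.indicator (1 : (Fin n → 𝒳 × ℝ) × (𝒳 × ℝ) → ℝ)) :=
      measurable_one.indicator hm
    exact h1.comp (measurable_fst.prodMk ((measurable_pi_apply i).comp measurable_snd))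
  · have hm : MeasurableSet {p : (Fin n → 𝒳 × ℝ) × (𝒳 × ℝ) | testResidual A p.1 p.2 < (q : ℝ)} :=
      measurableSet_lt (measurable_testResidual A) measurable_const
    exact ((measurable_measure_prodMk_left hm).comp measurable_fst).ennreal_toReal

omit [IsProbabilityMeasure P] in
-- The deviation only sees the last `m` points. In this form the sample and the residual function
-- come from two independent data sets, by `measurePreserving_swapLast`.
lemma swapDev_eq (m : ℕ) (D D' : Fin n → 𝒳 × ℝ) : swapDev A P m D D' =
    upperDev P (lastIdx n m) (testResidual A (swapLast m D D')) (swapLast m D' D) := by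
  unfold swapDev upperDev excessFreq
  refine iSup_congr fun q => ?_
  congr 3
  refine Finset.sum_congr rfl fun i hi => ?_
  have : ¬ (i : ℕ) < n - m := not_lt.2 (Finset.mem_filter.1 hi).2
  simp [swapLast, this]

lemma measurable_swapDev (m : ℕ) : Measurable
    fun p : (Fin n → 𝒳 × ℝ) × (Fin n → 𝒳 × ℝ) => swapDev A P m p.1 p.2 := by
  set G : (Fin n → 𝒳 × ℝ) × (Fin n → 𝒳 × ℝ) → ℝ := fun p =>
    upperDev P (lastIdx n m) (testResidual A p.1) p.2 with hG
  have h : Measurable G := measurable_upperDev_testResidual A P _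
  have h1 : (fun p : (Fin n → 𝒳 × ℝ) × (Fin n → 𝒳 × ℝ) => swapDev A P m p.1 p.2) =
      G ∘ fun p => (swapLast m p.1 p.2, swapLast m p.2 p.1) :=
    funext fun p => swapDev_eq A P m p.1 p.2
  rw [h1]
  exact h.comp (measurePreserving_swapLast P m).measurable

lemma lintegral_exp_swapDev_le {m : ℕ} (hm0 : 1 ≤ m) (hm : m ≤ n) {c : ℝ} (hc : 0 ≤ c) :
    ∫⁻ p : (Fin n → 𝒳 × ℝ) × (Fin n → 𝒳 × ℝ),
        ENNReal.ofReal (Real.exp (c * swapDev A P m p.1 p.2))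
        ∂((iidLaw P n).prod (iidLaw P n)) ≤
      2 * ENNReal.ofReal (Real.exp (1 + c ^ 2 / (2 * m))) := by
  set G : (Fin n → 𝒳 × ℝ) × (Fin n → 𝒳 × ℝ) → ℝ≥0∞ := fun p =>
    ENNReal.ofReal (Real.exp (c * upperDev P (lastIdx n m) (testResidual A p.1) p.2)) with hG
  have hmeas : Measurable G := (Real.measurable_exp.comp
      ((measurable_upperDev_testResidual A P _).const_mul c)).ennreal_ofReal
  have h1 : ∀ p : (Fin n → 𝒳 × ℝ) × (Fin n → 𝒳 × ℝ),
      ENNReal.ofReal (Real.exp (c * swapDev A P m p.1 p.2)) =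
        G (swapLast m p.1 p.2, swapLast m p.2 p.1) := fun p => by rw [swapDev_eq]
  rw [lintegral_congr h1, (measurePreserving_swapLast P m).lintegral_comp hmeas]
  rw [lintegral_prod _ hmeas.aemeasurable]
  have hI : (lastIdx n m).Nonempty := Finset.card_pos.1 (by rw [card_lastIdx hm]; exact hm0)
  calc _ ≤ ∫⁻ _ : Fin n → 𝒳 × ℝ, 2 * ENNReal.ofReal (Real.exp (1 + c ^ 2 / (2 * m)))
        ∂(iidLaw P n) := by
        refine lintegral_mono fun D => ?_
        have hr : Measurable (testResidual A D) :=
          (measurable_testResidual A).comp (measurable_const.prodMk measurable_id)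
        have := lintegral_exp_upperDev_le P hI hr hc
        rwa [card_lastIdx hm] at this
    _ = _ := by simp

variable [NeZero n]

lemma measurePreserving_cyclicShift (j : Fin n) : MeasurePreserving
    (fun p : (Fin n → 𝒳 × ℝ) × (Fin n → 𝒳 × ℝ) => (cyclicShift j p.1, p.2))
    ((iidLaw P n).prod (iidLaw P n)) ((iidLaw P n).prod (iidLaw P n)) := by
  have h : MeasurePreserving (cyclicShift j : (Fin n → 𝒳 × ℝ) → _) (iidLaw P n) (iidLaw P n) :=
    measurePreserving_pi_perm P (Equiv.addRight j)
  exact h.prod (MeasurePreserving.id _)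

lemma lintegral_avg_cyclicShift_le {f : (Fin n → 𝒳 × ℝ) → (Fin n → 𝒳 × ℝ) → ℝ≥0∞}
    (hf : Measurable fun p : (Fin n → 𝒳 × ℝ) × (Fin n → 𝒳 × ℝ) => f p.1 p.2) {b : ℝ≥0∞}
    (hb : ∫⁻ p, f p.1 p.2 ∂((iidLaw P n).prod (iidLaw P n)) ≤ b) :
    ∫⁻ p, (∑ j, f (cyclicShift j p.1) p.2) / (n : ℝ≥0∞)
      ∂((iidLaw P n).prod (iidLaw P n)) ≤ b := by
  have hmeas : ∀ j : Fin n, Measurable fun p : (Fin n → 𝒳 × ℝ) × (Fin n → 𝒳 × ℝ) =>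
      f (cyclicShift j p.1) p.2 := fun j =>
    hf.comp (measurePreserving_cyclicShift P j).measurable
  simp_rw [div_eq_mul_inv]
  rw [lintegral_mul_const _ (Finset.measurable_sum _ fun j _ => hmeas j),
    lintegral_finsetSum _ fun j _ => hmeas j, ← div_eq_mul_inv]
  refine ENNReal.div_le_of_le_mul ?_
  refine (Finset.sum_le_card_nsmul _ _ b fun j _ => ?_).trans ?_
  · exact ((measurePreserving_cyclicShift P j).lintegral_comp hf).le.trans hb
  · rw [Finset.card_univ, Fintype.card_fin, nsmul_eq_mul, mul_comm]

omit [MeasurableSpace 𝒳] in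
lemma exp_mul_avg_le (c : ℝ) (s : Fin n → ℝ) :
    Real.exp (c * ((∑ j, s j) / n)) ≤ (∑ j, Real.exp (c * s j)) / n := by
  have hn : (0 : ℝ) < n := by exact_mod_cast Nat.pos_of_ne_zero (NeZero.ne n)
  have h := convexOn_exp.map_sum_le (t := Finset.univ) (w := fun _ : Fin n => (1 / n : ℝ))
    (p := fun j => c * s j) (fun _ _ => by positivity) (by simp) (by simp)
  simp only [smul_eq_mul, ← Finset.mul_sum] at h
  have h1 : c * ((∑ j, s j) / n) = 1 / n * (c * ∑ j, s j) := by ring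
  have h2 : (∑ j, Real.exp (c * s j)) / n = 1 / n * ∑ j, Real.exp (c * s j) := by ring
  rw [h1, h2]
  exact h

/-- The shifted deviations are dependent but equally distributed, so Jensen's inequality transfers
the exponential moment to their average. -/
lemma measure_avg_swapDev_ge_le {m : ℕ} (hm0 : 1 ≤ m) (hm : m ≤ n) {x : ℝ} (hx : 0 ≤ x) :
    ((iidLaw P n).prod (iidLaw P n)) {p | x ≤ (∑ j, swapDev A P m (cyclicShift j p.1) p.2) / n} ≤
      ENNReal.ofReal (2 * Real.exp (1 - m * x ^ 2 / 2)) := by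
  have hn : (0 : ℝ) < n := by exact_mod_cast Nat.pos_of_ne_zero (NeZero.ne n)
  -- This minimizes the Chernoff exponent `c ^ 2 / (2 * m) - c * x`.
  set c : ℝ := m * x with hc
  have hc0 : 0 ≤ c := by positivity
  have hm' : (0 : ℝ) < m := by exact_mod_cast hm0
  have hmeas : Measurable fun p : (Fin n → 𝒳 × ℝ) × (Fin n → 𝒳 × ℝ) =>
      ENNReal.ofReal (Real.exp (c * swapDev A P m p.1 p.2)) :=
    (Real.measurable_exp.comp ((measurable_swapDev A P m).const_mul c)).ennreal_ofReal
  have hbound := lintegral_avg_cyclicShift_le P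
    (f := fun D D' => ENNReal.ofReal (Real.exp (c * swapDev A P m D D'))) hmeas
    (lintegral_exp_swapDev_le A P hm0 hm hc0)
  set G : (Fin n → 𝒳 × ℝ) × (Fin n → 𝒳 × ℝ) → ℝ≥0∞ := fun p =>
    (∑ j, ENNReal.ofReal (Real.exp (c * swapDev A P m (cyclicShift j p.1) p.2))) / (n : ℝ≥0∞)
    with hG
  have hGm : Measurable G := Measurable.div_const (Finset.measurable_sum _ fun j _ =>
    hmeas.comp (measurePreserving_cyclicShift P j).measurable) _
  have hsub : {p : (Fin n → 𝒳 × ℝ) × (Fin n → 𝒳 × ℝ) |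
      x ≤ (∑ j, swapDev A P m (cyclicShift j p.1) p.2) / n} ⊆
      {p | ENNReal.ofReal (Real.exp (c * x)) ≤ G p} := by
    intro p hp
    have h1 : Real.exp (c * x) ≤
        (∑ j, Real.exp (c * swapDev A P m (cyclicShift j p.1) p.2)) / n :=
      (Real.exp_le_exp.2 (mul_le_mul_of_nonneg_left hp hc0)).trans (exp_mul_avg_le c _)
    have h2 := ENNReal.ofReal_le_ofReal h1
    rwa [ENNReal.ofReal_div_of_pos hn, ENNReal.ofReal_natCast,
      ENNReal.ofReal_sum_of_nonneg fun j _ => (Real.exp_pos _).le] at h2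
  refine (measure_mono hsub).trans ?_
  refine (meas_ge_le_lintegral_div hGm.aemeasurable (by simp [Real.exp_pos])
    ENNReal.ofReal_ne_top).trans ?_
  refine (ENNReal.div_le_div_right hbound _).trans (le_of_eq ?_)
  rw [← ENNReal.ofReal_ofNat 2, ← ENNReal.ofReal_mul (by norm_num),
    ← ENNReal.ofReal_div_of_pos (Real.exp_pos _), mul_div_assoc, ← Real.exp_sub]
  congr 3
  rw [hc]
  field_simp
  ring

end Expectations

/-! ### The finite-sample bound -/

section FiniteSample

variable {𝒳 : Type u} [MeasurableSpace 𝒳] (A : RegressionAlgorithm 𝒳)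
  (P : Measure (𝒳 × ℝ)) [IsProbabilityMeasure P] {n : ℕ}

/-- The deterministic bound is used with `η = c'`. Outside `B₁` and `B₂` its error terms are below
`x` and `c'`, so the total excess over `α` is below `x + 2 * c'`. Taking `c'` above `c` keeps `η`
positive even when `c = 0`. -/
lemma measure_exceedSet_ge_le [NeZero n] {m : ℕ} (hm0 : 1 ≤ m) (hm : m < n + 1) {α γ : ℝ}
    (hα : 0 ≤ α) (hα1 : α ≤ 1) (hγ : 0 < γ) {c c' x : ℝ} (hc : 0 ≤ c) (hcc' : c < c')
    (hc'1 : c' ≤ 1) (hx : 0 ≤ x)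
    (hβ : inSwapStability A P m (n + 1) hm / ENNReal.ofReal γ ≤ ENNReal.ofReal (c ^ 3 / 2)) :
    iidLaw P n {D | ENNReal.ofReal (α + x + 2 * c') ≤ P (exceedSet A α γ D)} ≤
      ENNReal.ofReal c + ENNReal.ofReal (2 * Real.exp (1 - m * x ^ 2 / 2)) := by
  have hmn : m ≤ n := by omega
  have hn : (0 : ℝ) < n := by exact_mod_cast Nat.pos_of_ne_zero (NeZero.ne n)
  have hc'0 : 0 < c' := hc.trans_lt hcc'
  have hc'e : 0 < ENNReal.ofReal c' := ENNReal.ofReal_pos.2 hc'0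
  set T : (Fin n → 𝒳 × ℝ) × (Fin n → 𝒳 × ℝ) → ℝ≥0∞ := fun p =>
    (∑ j, testGap A P m γ (cyclicShift j p.1) p.2) / (n : ℝ≥0∞) with hT
  set V : (Fin n → 𝒳 × ℝ) × (Fin n → 𝒳 × ℝ) → ℝ≥0∞ := fun p =>
    (∑ j, ∫⁻ z, trainGap A m γ (cyclicShift j p.1) p.2 z ∂P) / (n : ℝ≥0∞) with hV
  have hTm : Measurable T := Measurable.div_const (Finset.measurable_sum _ fun j _ =>
    (measurable_testGap A P m γ).comp (measurePreserving_cyclicShift P j).measurable) _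
  have hVm : Measurable V := Measurable.div_const (Finset.measurable_sum _ fun j _ =>
    (measurable_lintegral_trainGap A P m γ).comp
      (measurePreserving_cyclicShift P j).measurable) _
  have hTi := (lintegral_avg_cyclicShift_le P (measurable_testGap A P m γ)
    (lintegral_testGap_le A P m hm γ)).trans hβ
  have hVi := (lintegral_avg_cyclicShift_le P
    (f := fun D D' => ∫⁻ z, trainGap A m γ D D' z ∂P) (measurable_lintegral_trainGap A P m γ)
    (lintegral_trainGap_le A P hm0 hm γ)).trans hβ
  set B₁ : Set ((Fin n → 𝒳 × ℝ) × (Fin n → 𝒳 × ℝ)) :=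
    {p | x ≤ (∑ j, swapDev A P m (cyclicShift j p.1) p.2) / n} with hB₁
  set B₂ : Set ((Fin n → 𝒳 × ℝ) × (Fin n → 𝒳 × ℝ)) :=
    {p | ENNReal.ofReal c' ≤ T p + V p / ENNReal.ofReal c'} with hB₂
  have hB₂le : ((iidLaw P n).prod (iidLaw P n)) B₂ ≤ ENNReal.ofReal c := by
    refine (meas_ge_le_lintegral_div (hTm.add (hVm.div_const _)).aemeasurable hc'e.ne'
      ENNReal.ofReal_ne_top).trans ?_
    simp only [Pi.add_apply]
    rw [lintegral_add_left hTm]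
    simp_rw [div_eq_mul_inv (V _)]
    rw [lintegral_mul_const _ hVm, ← div_eq_mul_inv]
    calc _ ≤ (ENNReal.ofReal (c ^ 3 / 2) + ENNReal.ofReal (c ^ 3 / 2) / ENNReal.ofReal c') /
          ENNReal.ofReal c' := by gcongr
      _ = ENNReal.ofReal ((c ^ 3 / 2 + c ^ 3 / 2 / c') / c') := by
          rw [← ENNReal.ofReal_div_of_pos hc'0, ← ENNReal.ofReal_add (by positivity)
            (by positivity), ← ENNReal.ofReal_div_of_pos hc'0]
      _ ≤ ENNReal.ofReal c := by
          refine ENNReal.ofReal_le_ofReal ?_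
          have h1 : (c ^ 3 / 2 + c ^ 3 / 2 / c') / c' = c * (c ^ 2 / c' ^ 2) * ((c' + 1) / 2) := by
            field_simp
          have h2 : c ^ 2 / c' ^ 2 ≤ 1 := div_le_one_of_le₀ (by gcongr) (by positivity)
          have h3 : (c' + 1) / 2 ≤ 1 := by linarith
          rw [h1]
          calc _ ≤ c * 1 * 1 := by gcongr
            _ = c := by ring
  have hsub : {D | ENNReal.ofReal (α + x + 2 * c') ≤ P (exceedSet A α γ D)} ×ˢ Set.univ ⊆
      B₂ ∪ B₁ := by
    rintro ⟨D, D'⟩ ⟨hD, -⟩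
    by_contra hnot
    simp only [Set.mem_union, not_or, hB₁, hB₂, Set.mem_ofPred_eq, not_le] at hnot hD
    obtain ⟨h2, h1⟩ := hnot
    have hdet := measure_exceedSet_add_le A P hm0 hmn hα hγ D D' hc'e ENNReal.ofReal_ne_top
    have hS : (∑ j, ENNReal.ofReal (swapDev A P m (cyclicShift j D) D')) / (n : ℝ≥0∞) =
        ENNReal.ofReal ((∑ j, swapDev A P m (cyclicShift j D) D') / n) := by
      have hnn : ∀ j ∈ Finset.univ, 0 ≤ swapDev A P m (cyclicShift j D) D' := fun j _ =>
        upperDev_nonneg P _ _ _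
      rw [ENNReal.ofReal_div_of_pos hn, ENNReal.ofReal_natCast, ENNReal.ofReal_sum_of_nonneg hnn]
    rw [hS, add_assoc _ ((∑ j, testGap A P m γ (cyclicShift j D) D') / (n : ℝ≥0∞))] at hdet
    have h3 : ENNReal.ofReal (α + x + 2 * c') + ENNReal.ofReal (1 - α) <
        ENNReal.ofReal c' + 1 + ENNReal.ofReal x + ENNReal.ofReal c' := by
      calc _ ≤ P (exceedSet A α γ D) + ENNReal.ofReal (1 - α) := by gcongr
        _ ≤ _ := hdet
        _ < _ := ENNReal.add_lt_add_of_le_of_lt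
          (ENNReal.add_ne_top.2 ⟨ENNReal.add_ne_top.2 ⟨by simp, by simp⟩, by simp⟩)
          (by gcongr) h2
    rw [← ENNReal.ofReal_one, ← ENNReal.ofReal_add (by positivity) (by linarith),
      ← ENNReal.ofReal_add (by positivity) (by norm_num),
      ← ENNReal.ofReal_add (by positivity) (by positivity),
      ← ENNReal.ofReal_add (by positivity) (by positivity)] at h3
    have h4 := (ENNReal.ofReal_lt_ofReal_iff_of_nonneg (by linarith)).1 h3
    linarith
  calc _ = ((iidLaw P n).prod (iidLaw P n))
        ({D | ENNReal.ofReal (α + x + 2 * c') ≤ P (exceedSet A α γ D)} ×ˢ Set.univ) := by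
        rw [Measure.prod_prod, measure_univ, mul_one]
    _ ≤ _ := (measure_mono hsub).trans ((measure_union_le _ _).trans
      (add_le_add hB₂le (measure_avg_swapDev_ge_le A P hm0 hmn hx)))

/-- Since `1 ≤ L`, the exponent satisfies `1 - t ≤ 2 / 5 - L`, and `exp (2 / 5) ≤ 3 / 2`. -/
lemma two_mul_exp_le {L : ℝ} (hL : 1 ≤ L) {t : ℝ} (ht : 1.6 * L ≤ t) :
    2 * Real.exp (1 - t) ≤ 3 * Real.exp (-L) := by
  have h1 : Real.exp (2 / 5) ≤ 3 / 2 := by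
    have h2 : Real.exp (2 / 5) ^ 5 ≤ (3 / 2) ^ 5 := by
      rw [← Real.exp_nat_mul]
      have h3 : Real.exp ((5 : ℕ) * (2 / 5)) = Real.exp 1 ^ 2 := by
        rw [← Real.exp_nat_mul]; norm_num
      rw [h3]
      have := Real.exp_one_lt_d9
      have h0 := Real.exp_pos 1
      nlinarith
    exact le_of_pow_le_pow_left₀ (by norm_num) (by norm_num) h2
  have h2 : Real.exp (1 - t) ≤ Real.exp (2 / 5) * Real.exp (-L) := by
    rw [← Real.exp_add]
    exact Real.exp_le_exp.2 (by linarith)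
  nlinarith [Real.exp_pos (-L)]

/-- The finite-sample bound, in terms of the measurable exceedance sets. -/
theorem measure_exceedSet_ge_sqrt_log_le (hn : 1 ≤ n) {m : ℕ} (hm0 : 1 ≤ m)
    (hmn : m - 1 < n + 1) {α γ δ : ℝ} (hα : 0 ≤ α) (hα1 : α ≤ 1) (hγ : 0 < γ)
    (hδ : 0 < δ) :
    iidLaw P n {D | ENNReal.ofReal
          (α + 3 * Real.sqrt (Real.log (1 / δ) / (2 * ((min n m : ℕ) : ℝ)))) +
        2 * (2 * inSwapStability A P (m - 1) (n + 1) hmn / ENNReal.ofReal γ) ^ (1 / 3 : ℝ) ≤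
        P (exceedSet A α γ D)} ≤
      3 * ENNReal.ofReal δ +
        (2 * inSwapStability A P (m - 1) (n + 1) hmn / ENNReal.ofReal γ) ^ (1 / 3 : ℝ) := by
  have : NeZero n := ⟨by omega⟩
  set C := (2 * inSwapStability A P (m - 1) (n + 1) hmn / ENNReal.ofReal γ) ^ (1 / 3 : ℝ) with hC
  set L := Real.log (1 / δ) with hL
  set s := Real.sqrt (L / (2 * ((min n m : ℕ) : ℝ))) with hs
  by_cases hC1 : 1 ≤ C
  · exact prob_le_one.trans (hC1.trans le_add_self)
  push Not at hC1
  by_cases hδ3 : 1 / 3 ≤ δ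
  · refine prob_le_one.trans (le_trans ?_ le_self_add)
    rw [← ENNReal.ofReal_ofNat 3, ← ENNReal.ofReal_mul (by norm_num), ← ENNReal.ofReal_one]
    exact ENNReal.ofReal_le_ofReal (by linarith)
  push Not at hδ3
  have hδL : Real.exp (-L) = δ := by
    rw [hL, one_div, Real.log_inv, neg_neg, Real.exp_log hδ]
  have hL1 : 1 < L := by
    by_contra h
    push Not at h
    have h1 : Real.exp (-1) ≤ δ := by rw [← hδL]; exact Real.exp_le_exp.2 (by linarith)
    have h2 : (1 : ℝ) / 3 < Real.exp (-1) := by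
      rw [Real.exp_neg, ← one_div]
      exact one_div_lt_one_div_of_lt (Real.exp_pos 1) (by linarith [Real.exp_one_lt_d9])
    linarith
  have hmin0 : (0 : ℝ) < ((min n m : ℕ) : ℝ) := by
    exact_mod_cast lt_min hn hm0
  have hs0 : 0 < s := Real.sqrt_pos.2 (by positivity)
  have hs2 : s ^ 2 = L / (2 * ((min n m : ℕ) : ℝ)) := Real.sq_sqrt (by positivity)
  by_cases hs1 : 1 < 3 * s
  · have hempty : {D : Fin n → 𝒳 × ℝ | ENNReal.ofReal (α + 3 * s) + 2 * C ≤
        P (exceedSet A α γ D)} = ∅ := by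
      refine Set.eq_empty_of_forall_notMem fun D hD => ?_
      have h1 : ENNReal.ofReal (α + 3 * s) ≤ 1 := le_self_add.trans (le_trans hD prob_le_one)
      rw [ENNReal.ofReal_le_one] at h1
      linarith
    rw [hempty, measure_empty]
    exact bot_le
  push Not at hs1
  -- From `3 * s ≤ 1` and `1 < L` the minimum exceeds `9 / 2`. This makes the loss from `m` to `m -
  -- 1` at most a factor `4 / 5`.
  have hmin5 : 5 ≤ min n m := by
    have h1 : 9 * s ^ 2 ≤ 1 := by nlinarith
    rw [hs2, mul_div_assoc', div_le_one (by positivity)] at h1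
    have h2 : (4 : ℝ) < ((min n m : ℕ) : ℝ) := by linarith
    exact_mod_cast h2
  have hCtop : C ≠ ∞ := (hC1.trans ENNReal.one_lt_top).ne
  set c := C.toReal with hc
  have hCc : C = ENNReal.ofReal c := (ENNReal.ofReal_toReal hCtop).symm
  have hc0 : 0 ≤ c := ENNReal.toReal_nonneg
  have hc1 : c < 1 := by
    rw [hCc, ENNReal.ofReal_lt_one] at hC1; exact hC1
  have hβ : inSwapStability A P (m - 1) (n + 1) hmn / ENNReal.ofReal γ ≤
      ENNReal.ofReal (c ^ 3 / 2) := by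
    have h1 : C ^ (3 : ℝ) = 2 * inSwapStability A P (m - 1) (n + 1) hmn / ENNReal.ofReal γ := by
      rw [hC, ← ENNReal.rpow_mul]; norm_num
    have h2 : C ^ (3 : ℝ) = ENNReal.ofReal (c ^ 3) := by
      rw [hCc, show (3 : ℝ) = ((3 : ℕ) : ℝ) by norm_num, ENNReal.rpow_natCast,
        ENNReal.ofReal_pow hc0]
    rw [ENNReal.ofReal_div_of_pos (by norm_num), ← h2, h1, ENNReal.ofReal_ofNat,
      mul_div_assoc, mul_comm 2, ENNReal.mul_div_cancel_right (by norm_num) (by norm_num)]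
  -- The budget `3 * s` is split as `2.85 * s` for the deviation and `2 * 0.075 * s` to make `c'`
  -- exceed `c`.
  set c' := min 1 (c + 0.075 * s) with hc'
  have hcc' : c < c' := lt_min hc1 (by linarith)
  have h := measure_exceedSet_ge_le A P (m := m - 1) (by omega) hmn hα hα1 hγ hc0 hcc'
    (min_le_left _ _) (x := 2.85 * s) (by positivity) hβ
  refine (measure_mono fun D hD => ?_).trans (h.trans ?_)
  · have hD' : ENNReal.ofReal (α + 3 * s) + 2 * C ≤ P (exceedSet A α γ D) := hD
    refine le_trans ?_ hD'
    rw [hCc, ← ENNReal.ofReal_ofNat 2, ← ENNReal.ofReal_mul (by norm_num),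
      ← ENNReal.ofReal_add (by positivity) (by positivity)]
    refine ENNReal.ofReal_le_ofReal ?_
    linarith [min_le_right 1 (c + 0.075 * s)]
  · rw [add_comm, hCc]
    gcongr
    rw [← ENNReal.ofReal_ofNat 3, ← ENNReal.ofReal_mul (by norm_num)]
    refine ENNReal.ofReal_le_ofReal ?_
    rw [← hδL]
    refine two_mul_exp_le hL1.le ?_
    have hM : (4 / 5 : ℝ) * ((min n m : ℕ) : ℝ) ≤ ((m - 1 : ℕ) : ℝ) := by
      have h1 : min n m ≤ (m - 1) + 1 := by omega
      have h2 : 4 ≤ m - 1 := by omega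
      have h1' : ((min n m : ℕ) : ℝ) ≤ ((m - 1 : ℕ) : ℝ) + 1 := by exact_mod_cast h1
      have h2' : (4 : ℝ) ≤ ((m - 1 : ℕ) : ℝ) := by exact_mod_cast h2
      linarith
    have h3 : ((m - 1 : ℕ) : ℝ) * (2.85 * s) ^ 2 / 2 =
        ((m - 1 : ℕ) : ℝ) * (2.85 ^ 2 * L) / (4 * ((min n m : ℕ) : ℝ)) := by
      rw [mul_pow, hs2]; field_simp; ring
    rw [h3, le_div_iff₀ (by positivity)]
    -- The numerical margin is `(4 / 5) * 2.85 ^ 2 / 4 = 1.6245`, above `1.6`.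
    nlinarith

end FiniteSample

/-! ### Limits for the asymptotic bound -/

section Asymptotics

lemma tendsto_min_floor_sqrt {ρ : ℕ → ℝ} (hρ : ∀ n, 0 < ρ n) (h : Tendsto ρ atTop (𝓝 0)) :
    Tendsto (fun n => min n (min n ⌊Real.sqrt (ρ n)⁻¹⌋₊ + 1)) atTop atTop := by
  have h1 : Tendsto (fun n => ⌊Real.sqrt (ρ n)⁻¹⌋₊) atTop atTop :=
    tendsto_nat_floor_atTop.comp (Real.tendsto_sqrt_atTop.comp (tendsto_inv_nhdsGT_zero.comp
      (tendsto_nhdsWithin_iff.2 ⟨h, Eventually.of_forall hρ⟩)))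
  refine tendsto_atTop.2 fun K => ?_
  filter_upwards [h1.eventually_ge_atTop K, eventually_ge_atTop K] with n hn hn'
  omega

lemma tendsto_exp_neg_sqrt {M : ℕ → ℕ} (h : Tendsto M atTop atTop) :
    Tendsto (fun n => Real.exp (-Real.sqrt (M n))) atTop (𝓝 0) :=
  Real.tendsto_exp_neg_atTop_nhds_zero.comp
    (Real.tendsto_sqrt_atTop.comp (tendsto_natCast_atTop_atTop.comp h))

lemma tendsto_sqrt_sqrt_div {M : ℕ → ℕ} (h : Tendsto M atTop atTop) :
    Tendsto (fun n => Real.sqrt (Real.sqrt (M n) / (2 * (M n : ℝ)))) atTop (𝓝 0) := by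
  have h1 : Tendsto (fun n => Real.sqrt (M n : ℝ)) atTop atTop :=
    Real.tendsto_sqrt_atTop.comp (tendsto_natCast_atTop_atTop.comp h)
  have h2 : ∀ n, Real.sqrt (M n) / (2 * (M n : ℝ)) = (Real.sqrt (M n))⁻¹ * (1 / 2) := by
    intro n
    rcases Nat.eq_zero_or_pos (M n) with h0 | h0
    · simp [h0]
    · have h3 : (0 : ℝ) < M n := by exact_mod_cast h0
      have h4 := Real.mul_self_sqrt h3.le
      have h5 := Real.sqrt_pos.2 h3
      rw [← h4]
      simp only [Real.sqrt_mul_self h5.le]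
      field_simp
  simp_rw [h2]
  have := ((tendsto_inv_atTop_zero.comp h1).mul_const (1 / 2)).sqrt
  simpa using this

variable {𝒳 : Type u} [MeasurableSpace 𝒳] (A : RegressionAlgorithm 𝒳)
  (P : Measure (𝒳 × ℝ)) [IsProbabilityMeasure P] {n : ℕ}

/-- Swapping `k` points multiplies the ratio `b / γ` by at most `k`; with `k` up to its inverse
square root, the product is still at most its square root. -/
lemma inSwapStability_ratio_le (hn : 1 ≤ n) {b γ : ℝ} (hb : 0 < b) (hγ : 0 < γ)
    (h : inSwapStabilitySup A P (n + 1) ≤ ENNReal.ofReal b) {k : ℕ} (hk : k < n + 1)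
    (hk' : (k : ℝ) ≤ Real.sqrt (b / γ)⁻¹) :
    (2 * inSwapStability A P k (n + 1) hk / ENNReal.ofReal γ) ^ (1 / 3 : ℝ) ≤
      ENNReal.ofReal ((2 * Real.sqrt (b / γ)) ^ (1 / 3 : ℝ)) := by
  have h1 : inSwapStability A P 1 (n + 1) (by omega) ≤ ENNReal.ofReal b := by
    refine le_trans ?_ h
    unfold inSwapStabilitySup
    exact le_iSup_of_le (n + 1) (le_iSup_of_le (by omega) (le_iSup_of_le le_rfl le_rfl))
  have h2 : inSwapStability A P k (n + 1) hk ≤ ENNReal.ofReal (k * b) := by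
    refine (inSwapStability_le_mul A P k hk (by omega)).trans ?_
    rw [ENNReal.ofReal_mul (Nat.cast_nonneg _), ENNReal.ofReal_natCast]
    gcongr
  rw [← ENNReal.ofReal_rpow_of_nonneg (by positivity) (by norm_num)]
  refine ENNReal.rpow_le_rpow ?_ (by norm_num)
  calc _ ≤ 2 * ENNReal.ofReal (k * b) / ENNReal.ofReal γ := by gcongr
    _ = ENNReal.ofReal (2 * (k * b) / γ) := by
        rw [ENNReal.ofReal_div_of_pos hγ, ENNReal.ofReal_mul (p := 2) (by norm_num), ENNReal.ofReal_ofNat]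
    _ ≤ _ := by
        refine ENNReal.ofReal_le_ofReal ?_
        have hr : 0 < b / γ := by positivity
        have h3 : Real.sqrt (b / γ)⁻¹ * (b / γ) = Real.sqrt (b / γ) := by
          have h4 := Real.mul_self_sqrt hr.le
          have h5 := Real.sqrt_pos.2 hr
          rw [Real.sqrt_inv]
          nth_rewrite 2 [← h4]
          field_simp
        calc 2 * (k * b) / γ = 2 * (k * (b / γ)) := by ring
          _ ≤ 2 * (Real.sqrt (b / γ)⁻¹ * (b / γ)) := by gcongr
          _ = _ := by rw [h3]

end Asymptotics

/-! ### The main theorem -/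

theorem theorem9 :
    -- finite-sample guarantee
    (∀ (𝒳 : Type u) [MeasurableSpace 𝒳] (A : RegressionAlgorithm 𝒳)
        (P : Measure (𝒳 × ℝ)) [IsProbabilityMeasure P]
        (α : ℝ) (_ : 0 ≤ α) (_ : α ≤ 1) (n : ℕ) (_ : 1 ≤ n) (γ : ℝ) (_ : 0 < γ)
        (m : ℕ) (_ : 1 ≤ m) (hmn : m - 1 < n + 1) (δ : ℝ) (_ : 0 < δ) (_ : δ < 1),
        1 - 3 * ENNReal.ofReal δ
            - (2 * inSwapStability A P (m - 1) (n + 1) hmn / ENNReal.ofReal γ) ^ (1 / 3 : ℝ)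
          ≤ iidLaw P n
            {D : Fin n → 𝒳 × ℝ | ENNReal.ofReal (miscoverage A P α γ D) <
              ENNReal.ofReal
                  (α + 3 * Real.sqrt (Real.log (1 / δ) / (2 * ((min n m : ℕ) : ℝ))))
                + 2 * (2 * inSwapStability A P (m - 1) (n + 1) hmn / ENNReal.ofReal γ)
                    ^ (1 / 3 : ℝ)}) ∧
    -- asymptotic guarantee
    (∀ (b γ : ℕ → ℝ), (∀ n, 0 < b n) → (∀ n, 0 < γ n) →
        Tendsto (fun n => b n / γ n) atTop (𝓝 0) →
        ∃ ε : ℕ → ℝ, Tendsto ε atTop (𝓝 0) ∧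
          ∀ (𝒳 : Type u) [MeasurableSpace 𝒳] (α : ℝ), 0 ≤ α → α ≤ 1 →
            Tendsto
              (fun n : ℕ =>
                ⨆ (A : RegressionAlgorithm 𝒳) (P : ProbabilityMeasure (𝒳 × ℝ))
                  (_ : inSwapStabilitySup A (P : Measure (𝒳 × ℝ)) (n + 1)
                    ≤ ENNReal.ofReal (b n)),
                  iidLaw (P : Measure (𝒳 × ℝ)) n
                    {D : Fin n → 𝒳 × ℝ |
                      α + ε n ≤ miscoverage A (P : Measure (𝒳 × ℝ)) α (γ n) D})
              atTop (𝓝 (0 : ℝ≥0∞))) := by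
  refine ⟨?_, ?_⟩
  · intro 𝒳 _ A P _ α hα hα1 n hn γ hγ m hm hmn δ hδ _
    set S := {D : Fin n → 𝒳 × ℝ | ENNReal.ofReal (miscoverage A P α γ D) <
      ENNReal.ofReal (α + 3 * Real.sqrt (Real.log (1 / δ) / (2 * ((min n m : ℕ) : ℝ)))) +
        2 * (2 * inSwapStability A P (m - 1) (n + 1) hmn / ENNReal.ofReal γ) ^ (1 / 3 : ℝ)}
    have hbad := measure_exceedSet_ge_sqrt_log_le A P hn hm hmn hα hα1 hγ hδ
    have hcompl := (measure_mono (s := Sᶜ) fun D hD => by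
      simp only [S, Set.mem_compl_iff, Set.mem_ofPred_eq, not_lt] at hD ⊢
      exact hD.trans (miscoverage_le A P hn hα1 D)).trans hbad
    -- Subadditivity suffices here, so measurability of `S` is not needed.
    have huniv : 1 ≤ iidLaw P n S + iidLaw P n Sᶜ := by
      rw [← measure_univ (μ := iidLaw P n), ← Set.union_compl_self S]
      exact measure_union_le _ _
    rw [tsub_tsub, tsub_le_iff_right]
    exact huniv.trans (by gcongr)
  · intro b γ hb hγ hlim
    have hρ : ∀ n, 0 < b n / γ n := fun n => div_pos (hb n) (hγ n)
    -- The swap size tends to infinity, yet slowly enough that `k n * b n / γ n` tends to zero.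
    set k : ℕ → ℕ := fun n => min n ⌊Real.sqrt (b n / γ n)⁻¹⌋₊ with hk
    set M : ℕ → ℕ := fun n => min n (k n + 1) with hM
    have hMlim : Tendsto M atTop atTop := tendsto_min_floor_sqrt hρ hlim
    set c : ℕ → ℝ := fun n => (2 * Real.sqrt (b n / γ n)) ^ (1 / 3 : ℝ) with hc
    have hc0 : ∀ n, 0 ≤ c n := fun n => by positivity
    have hclim : Tendsto c atTop (𝓝 0) := by
      have h := (hlim.sqrt.const_mul 2).rpow_const (p := (1 / 3 : ℝ)) (Or.inr (by norm_num))
      rw [Real.sqrt_zero, mul_zero, Real.zero_rpow (by norm_num)] at h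
      exact h
    set s : ℕ → ℝ := fun n => Real.sqrt (Real.sqrt (M n) / (2 * (M n : ℝ))) with hs
    have hslim : Tendsto s atTop (𝓝 0) := tendsto_sqrt_sqrt_div hMlim
    refine ⟨fun n => 3 * s n + 2 * c n, ?_, ?_⟩
    · simpa using (hslim.const_mul 3).add (hclim.const_mul 2)
    · intro 𝒳 _ α hα hα1
      have hup : Tendsto (fun n => 3 * ENNReal.ofReal (Real.exp (-Real.sqrt (M n))) +
          ENNReal.ofReal (c n)) atTop (𝓝 0) := by
        have h1 := ENNReal.tendsto_ofReal (tendsto_exp_neg_sqrt hMlim)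
        have h2 := ENNReal.tendsto_ofReal hclim
        have h3 := (ENNReal.Tendsto.const_mul (a := 3) h1 (Or.inr (by norm_num))).add h2
        simpa using h3
      refine tendsto_of_tendsto_of_tendsto_of_le_of_le' tendsto_const_nhds hup
        (Eventually.of_forall fun _ => bot_le) ?_
      filter_upwards [eventually_ge_atTop 1] with n hn
      refine iSup_le fun A => iSup_le fun P => iSup_le fun hP => ?_
      have hkn : k n < n + 1 := Nat.lt_succ_of_le (min_le_left _ _)
      have hkr : (k n : ℝ) ≤ Real.sqrt (b n / γ n)⁻¹ :=
        (Nat.cast_le.2 (min_le_right _ _)).trans (Nat.floor_le (Real.sqrt_nonneg _))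
      have hC := inSwapStability_ratio_le A (P : Measure (𝒳 × ℝ)) hn (hb n) (hγ n) hP hkn hkr
      -- With `δ = exp (-√M)`, both `δ` and `log (1 / δ) / M = 1 / √M` tend to zero.
      have hbad := measure_exceedSet_ge_sqrt_log_le A (P : Measure (𝒳 × ℝ)) hn
        (m := k n + 1) (by omega) hkn hα hα1 (hγ n) (Real.exp_pos (-Real.sqrt (M n)))
      simp only [Nat.add_sub_cancel] at hbad
      refine le_trans (measure_mono fun D hD => ?_) (hbad.trans (by gcongr))
      have hlog : Real.log (1 / Real.exp (-Real.sqrt (M n))) = Real.sqrt (M n) := by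
        rw [one_div, Real.log_inv, Real.log_exp, neg_neg]
      have hD' : α + (3 * s n + 2 * c n) ≤ miscoverage A (P : Measure (𝒳 × ℝ)) α (γ n) D := hD
      have hs0 : 0 ≤ s n := Real.sqrt_nonneg _
      rw [Set.mem_ofPred_eq, hlog]
      calc _ ≤ ENNReal.ofReal (α + 3 * s n) + 2 * ENNReal.ofReal (c n) := by
            gcongr
        _ = ENNReal.ofReal (α + (3 * s n + 2 * c n)) := by
            rw [← ENNReal.ofReal_ofNat 2, ← ENNReal.ofReal_mul (by norm_num),
              ← ENNReal.ofReal_add (by positivity) (by have := hc0 n; positivity), add_assoc]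
        _ ≤ _ := (ENNReal.ofReal_le_ofReal hD').trans
            (miscoverage_le A (P : Measure (𝒳 × ℝ)) hn hα1 D)
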